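/- Let $\Pi\subset\mathbb{R}^4$ be a two-dimensional linear subspace and let $f:\Sigma\to\mathbb{R}^4$ be a smooth immersed surface. For two-dimensional subspaces $V,W\subset\mathbb{R}^4$ the principal angles $0\le\theta_1\le\theta_2\le\pi/2$ are given by $\cos\theta_1=\langle v_1,w_1\rangle=\max\{\langle v,w\rangle: v\in V,\ w\in W,\ |v|=|w|=1\}$ and $\cos\theta_2=\max\{\langle v,w\rangle: v\in V,\ w\in W,\ |v|=|w|=1,\ v\perp v_1,\ w\perp w_1\}$. For a regular curve $c:J\to\mathbb{R}^4$ on an open interval $J$, write $\nu_{c(s)}=c'(s)^\perp$ for its normal space at the parameter $s$; the holonomy tube over $c$ through $\xi_0\in\nu_{c(s_0)}$ is $\{c(s)+\xi(s): s\in J\}$, where $\xi$ is the normal vector field along $c$ with $\xi(s_0)=\xi_0$ that is parallel for the normal connection. Suppose that there is a constant $\theta_2$ such that at every $x\in\Sigma$ the principal angles between the tangent plane $T_x\Sigma$ (as a subspace of $\mathbb{R}^4$) and $\Pi$ are $\theta_1=0$ and $\theta_2$. Then there is a rigid motion $\varphi$ of $\mathbb{R}^4$, which can be taken to be a translation, such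 that every $x\in\Sigma$ has arbitrarily small open neighbourhoods $U$ for which the following holds. There are a smooth regular plane curve $c:J\to\Pi$ on an open interval, a parameter $s_0\in J$ with $p=c(s_0)$, and a smooth regular curve $\gamma:K\to\nu_p=c'(s_0)^\perp\cong\mathbb{R}^3$ on a nonempty open interval, such that $\varphi(f(U))$ is the union over $r\in K$ of the holonomy tubes over $c$ through $\gamma(r)$. Moreover $\gamma$ is a helix (a curve of constant slope) of $\nu_p\cong\mathbb{R}^3$: its tangent vectors make a constant angle, equal to $\theta_2$, with a unit vector $N\in\Pi$ normal to $c$ at $p$. -/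

import Mathlib

open Set Topology
open scoped Manifold ContDiff RealInnerProductSpace

/-- Euclidean four-space. -/
abbrev R4 := EuclideanSpace ℝ (Fin 4)

/-- `0 ≤ θ₁ ≤ θ₂ ≤ π / 2` are the principal angles between the subspaces `V` and `W`:
`cos θ₁` is the maximum of `⟪v, w⟫` over unit vectors `v ∈ V`, `w ∈ W`, attained at `(v₁, w₁)`,
and `cos θ₂` is the maximum over those unit vectors with moreover `v ⊥ v₁` and `w ⊥ w₁`. -/
structure ArePrincipalAngles (V W : Submodule ℝ R4) (θ₁ θ₂ : ℝ) : Prop where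
  nonneg : 0 ≤ θ₁
  le : θ₁ ≤ θ₂
  le_pi_div_two : θ₂ ≤ Real.pi / 2
  exists_vectors : ∃ v₁ ∈ V, ∃ w₁ ∈ W, ‖v₁‖ = 1 ∧ ‖w₁‖ = 1 ∧ ⟪v₁, w₁⟫ = Real.cos θ₁ ∧
    IsGreatest {t : ℝ | ∃ v ∈ V, ∃ w ∈ W, ‖v‖ = 1 ∧ ‖w‖ = 1 ∧ t = ⟪v, w⟫} (Real.cos θ₁) ∧
    IsGreatest {t : ℝ | ∃ v ∈ V, ∃ w ∈ W, ‖v‖ = 1 ∧ ‖w‖ = 1 ∧ ⟪v, v₁⟫ = 0 ∧ ⟪w, w₁⟫ = 0 ∧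
      t = ⟪v, w⟫} (Real.cos θ₂)

section Surfaces

variable {M : Type*} [TopologicalSpace M] [ChartedSpace (EuclideanSpace ℝ (Fin 2)) M]

/-- A smooth immersion of a two-dimensional manifold into `ℝ⁴`. -/
structure IsImmersedSurface (f : M → R4) : Prop where
  contMDiff : ContMDiff (𝓡 2) 𝓘(ℝ, R4) ∞ f
  injective_mfderiv : ∀ x, Function.Injective (mfderiv (𝓡 2) 𝓘(ℝ, R4) f x)

/-- The tangent plane at `x` of the surface `f`, as a linear subspace of `ℝ⁴`. -/
noncomputable def tangentPlane (f : M → R4) (x : M) : Submodule ℝ R4 :=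
  LinearMap.range
    (show EuclideanSpace ℝ (Fin 2) →L[ℝ] R4 from mfderiv (𝓡 2) 𝓘(ℝ, R4) f x).toLinearMap

/-- The principal angles between the tangent planes of `f` and the plane `P` are
`θ₁` and `θ₂` at every point. -/
def HasConstantPrincipalAngles (f : M → R4) (P : Submodule ℝ R4) (θ₁ θ₂ : ℝ) : Prop :=
  ∀ x : M, ArePrincipalAngles (tangentPlane f x) P θ₁ θ₂

end Surfaces

/-- `c` restricted to `J` is a smooth regular curve. -/
structure IsRegularCurve (c : ℝ → R4) (J : Set ℝ) : Prop where
  contDiffOn : ContDiffOn ℝ ∞ c J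
  deriv_ne_zero : ∀ s ∈ J, deriv c s ≠ 0

/-- The normal space of the curve `c` at the parameter `s`; it is three-dimensional where
`deriv c s ≠ 0`. -/
noncomputable def normalSpace (c : ℝ → R4) (s : ℝ) : Submodule ℝ R4 :=
  (Submodule.span ℝ {deriv c s})ᗮ

/-- `ξ` is a normal vector field along the curve `c` on `J`, parallel with respect to the normal
connection: its derivative has vanishing normal component. -/
structure IsNormalParallel (c : ℝ → R4) (J : Set ℝ) (ξ : ℝ → R4) : Prop where
  normal : ∀ s ∈ J, ξ s ∈ normalSpace c s
  differentiableAt : ∀ s ∈ J, DifferentiableAt ℝ ξ s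
  parallel : ∀ s ∈ J, (normalSpace c s).starProjection (deriv ξ s) = 0

/-- The holonomy tube over the curve `c` on `J` through the normal vector `ξ₀` at `c s₀`: all
end points `c s + ξ s`, where `ξ` is the parallel transport of `ξ₀` along `c` in the normal
bundle. -/
def holonomyTube (c : ℝ → R4) (J : Set ℝ) (s₀ : ℝ) (ξ₀ : R4) : Set R4 :=
  {q | ∃ ξ : ℝ → R4, IsNormalParallel c J ξ ∧ ξ s₀ = ξ₀ ∧ ∃ s ∈ J, q = c s + ξ s}

/-- `γ` restricted to `K` is a helix (a curve of constant slope) with axis direction `d`: a smooth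
regular curve whose tangent vectors make the constant angle `θ` with `d`. -/
structure IsHelix (γ : ℝ → R4) (K : Set ℝ) (d : R4) (θ : ℝ) : Prop where
  regular : IsRegularCurve γ K
  angle_eq : ∀ r ∈ K, InnerProductGeometry.angle (deriv γ r) d = θ

/-- The set `S` is the union of the holonomy tubes over a smooth regular plane curve `c ⊂ P`
(parametrized by an open interval) through the normal vectors `γ r` at a point `p = c s₀`,
where `γ` is a curve in the normal space of `c` at `p`, parametrized by an open interval, which is
a helix making the angle `θ` with the unit normal `N ∈ P` of the plane curve `c` at `p`. -/
def IsUnionOfHolonomyTubes (P : Submodule ℝ R4) (θ : ℝ) (S : Set R4) : Prop :=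
  ∃ (c γ : ℝ → R4) (a b s₀ a' b' : ℝ) (N : R4),
    s₀ ∈ Ioo a b ∧ a' < b' ∧
    IsRegularCurve c (Ioo a b) ∧ (∀ s ∈ Ioo a b, c s ∈ P) ∧
    N ∈ P ∧ ‖N‖ = 1 ∧ N ∈ normalSpace c s₀ ∧
    (∀ r ∈ Ioo a' b', γ r ∈ normalSpace c s₀) ∧
    IsHelix γ (Ioo a' b') N θ ∧
    S = ⋃ r ∈ Ioo a' b', holonomyTube c (Ioo a b) s₀ (γ r)

/-! ### Linear algebra of two planes meeting at principal angles `0` and `θ`. -/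

section Planes

/-! The angle `0` says that every tangent plane contains a direction of `P`; the remaining tangent
direction rises out of `P` at the constant angle `θ`.

Let `θ > 0` and split the immersion as `F = u + v` with `u` in `P` and `v` in `Pᗮ`. The differential
of `v` has rank one, so if a height `t = ⟪e, F⟫` with `e ∈ Pᗮ` serves as second coordinate, then `v
= β t` is a curve and the level curves of `t` are plane curves parallel to `P`. Let `N ∈ P` be the
unit normal of their projections to `P`. The angle condition becomes `sin θ * |⟪N, ∂ₜu⟫| = cos θ *
‖β'‖`, so the projected level curves move with a normal speed `κ t` that is the same along each of
them. As with wave fronts, they are then parallel curves of one another: equality of mixed partials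
(`exists_transport`) shows that `N` and `w = u - R t • N`, where `R' = κ`, are constant along one
common vector field. Straightening this field (`exists_isUnionOfHolonomyTubes_of_frame`) gives `F =
c s + R t • n s + β t`.

For fixed `t` the field `R t • n s + β t` is normal and parallel along `c`, because `n'` is tangent
to the plane curve `c` and `β t` does not depend on `s`. Its values at `s₀` form `γ`, with `γ' = κ •
n + β'`, and the slope relation is exactly the helix condition (`isUnionOfHolonomyTubes_of_eq`). If
`θ = 0`, the surface is locally an open piece of a translate of `P`, treated separately with a
straight base line. -/

lemma exists_orthonormal_pair (V : Submodule ℝ R4) (hV : Module.finrank ℝ V = 2) :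
    ∃ e ∈ V, ∃ v ∈ V, ‖e‖ = 1 ∧ ‖v‖ = 1 ∧ ⟪e, v⟫ = 0 := by
  let b := (stdOrthonormalBasis ℝ V).reindex (finCongr hV)
  refine ⟨b 0, (b 0).2, b 1, (b 1).2, ?_, ?_, ?_⟩
  · exact b.orthonormal.1 0
  · exact b.orthonormal.1 1
  · exact b.orthonormal.2 (show (0 : Fin 2) ≠ 1 by simp)

lemma eq_add_of_orthonormal_pair {V : Submodule ℝ R4} (hV : Module.finrank ℝ V = 2)
    {e v : R4} (he : e ∈ V) (hv : v ∈ V) (he1 : ‖e‖ = 1) (hv1 : ‖v‖ = 1) (hev : ⟪e, v⟫ = 0)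
    {a : R4} (ha : a ∈ V) : a = ⟪a, e⟫ • e + ⟪a, v⟫ • v := by
  have ho : Orthonormal ℝ ![(⟨e, he⟩ : V), ⟨v, hv⟩] := by
    constructor
    · intro i
      fin_cases i
      · exact he1
      · exact hv1
    · intro i j hij
      fin_cases i <;> fin_cases j
      · exact absurd rfl hij
      · exact hev
      · exact (real_inner_comm _ _).trans hev
      · exact absurd rfl hij
  have hc : Fintype.card (Fin 2) = Module.finrank ℝ V := by simp [hV]
  let b := (basisOfOrthonormalOfCardEqFinrank ho hc).toOrthonormalBasis (by simpa using ho)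
  have hb : ∀ i, b i = ![(⟨e, he⟩ : V), ⟨v, hv⟩] i := by intro i; simp [b]
  have h := b.sum_repr' ⟨a, ha⟩
  rw [Fin.sum_univ_two, hb, hb] at h
  have h' := congrArg (Subtype.val) h
  simp only [Matrix.cons_val_zero, Matrix.cons_val_one, Submodule.coe_add, Submodule.coe_smul,
    Submodule.coe_inner] at h'
  rw [real_inner_comm e a, real_inner_comm v a]
  exact h'.symm

/-- The rotation by a right angle in a plane, extended by zero. -/
lemma exists_rotation (P : Submodule ℝ R4) (hP : Module.finrank ℝ P = 2) :
    ∃ J : R4 →L[ℝ] R4, (∀ x, J x ∈ P) ∧ (∀ x, ⟪J x, x⟫ = 0) ∧ ∀ x ∈ P, ‖J x‖ = ‖x‖ := by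
  obtain ⟨e, he, v, hv, he1, hv1, hev⟩ := exists_orthonormal_pair P hP
  have hve : ⟪v, e⟫ = 0 := (real_inner_comm _ _).trans hev
  let J : R4 →L[ℝ] R4 := (innerSL ℝ e).smulRight v - (innerSL ℝ v).smulRight e
  have hJ : ∀ x, J x = ⟪e, x⟫ • v - ⟪v, x⟫ • e := fun x ↦ by simp [J]
  have hmem : ∀ x, J x ∈ P := fun x ↦ by
    rw [hJ]; exact P.sub_mem (P.smul_mem _ hv) (P.smul_mem _ he)
  have horth : ∀ x, ⟪J x, x⟫ = 0 := fun x ↦ by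
    rw [hJ, inner_sub_left, inner_smul_left, inner_smul_left]; simp; ring
  have hnorm : ∀ x ∈ P, ‖J x‖ = ‖x‖ := fun x hx ↦ by
    have h1 : ‖J x‖ ^ 2 = ‖x‖ ^ 2 := by
      conv_rhs => rw [eq_add_of_orthonormal_pair hP he hv he1 hv1 hev hx]
      rw [hJ, ← real_inner_self_eq_norm_sq, ← real_inner_self_eq_norm_sq]
      simp only [inner_sub_left, inner_sub_right, inner_add_left, inner_add_right,
        inner_smul_left, inner_smul_right, hev, hve, real_inner_self_eq_norm_sq, he1, hv1,
        real_inner_comm e x, real_inner_comm v x]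
      simp
    exact (sq_eq_sq₀ (norm_nonneg _) (norm_nonneg _)).1 h1
  exact ⟨J, hmem, horth, hnorm⟩

/-- A plane with principal angles `0` and `θ` to `P` has a basis `e, v` with `e ∈ P` and
`v = cos θ • w + η`, where `w ∈ P` and `η ∈ Pᗮ`. -/
lemma ArePrincipalAngles.exists_basis {T P : Submodule ℝ R4} {θ : ℝ}
    (hT : Module.finrank ℝ T = 2) (hP : Module.finrank ℝ P = 2)
    (h : ArePrincipalAngles T P 0 θ) :
    ∃ e w η : R4, e ∈ P ∧ w ∈ P ∧ η ∈ Pᗮ ∧ ‖e‖ = 1 ∧ ‖w‖ = 1 ∧ ⟪e, w⟫ = 0 ∧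
      ‖η‖ = Real.sin θ ∧ Real.cos θ • w + η ∈ T ∧
      ∀ a ∈ T, ∃ x y : ℝ, a = x • e + y • (Real.cos θ • w + η) := by
  obtain ⟨v₁, hv₁, w₁, hw₁, hnv, hnw, hin, -, ⟨v, hv, w, hw, hv1, hw1, hvv, hww, hc⟩, -⟩ :=
    h.exists_vectors
  have hs : 0 ≤ Real.sin θ := Real.sin_nonneg_of_nonneg_of_le_pi h.le
    (h.le_pi_div_two.trans (by linarith [Real.pi_pos]))
  -- Equality in Cauchy–Schwarz: angle `0` forces `v₁ = w₁`, a common unit vector of `T` and `P`.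
  rw [Real.cos_zero, inner_eq_one_iff_of_norm_eq_one hnv hnw] at hin
  subst hin
  have hvw : ⟪v₁, w⟫ = 0 := (real_inner_comm _ _).trans hww
  have hdec : v = Real.cos θ • w + (v - Real.cos θ • w) := by abel
  -- `P` is spanned by `v₁` and `w`; the difference is orthogonal to `v₁` since both `v` and `w`
  -- are, and to `w` since `⟪v, w⟫ = cos θ`.
  have hη : v - Real.cos θ • w ∈ Pᗮ := by
    rw [Submodule.mem_orthogonal]
    intro u hu
    rw [eq_add_of_orthonormal_pair hP hw₁ hw hnv hw1 hvw hu]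
    simp only [inner_sub_right, inner_add_left, inner_smul_left, inner_smul_right, hvw,
      (real_inner_comm _ _).trans hvv, real_inner_self_eq_norm_sq, hw1, hc,
      real_inner_comm v w]
    simp [mul_comm]
  refine ⟨v₁, w, v - Real.cos θ • w, hw₁, hw, hη, hnv, hw1, hvw, ?_, ?_, ?_⟩
  · rw [← sq_eq_sq₀ (norm_nonneg _) hs, norm_sub_sq_real, norm_smul, inner_smul_right, ← hc, hv1,
      hw1, Real.sin_sq]
    simp
    ring
  · rwa [← hdec]
  · intro a ha
    rw [← hdec]
    exact ⟨_, _, eq_add_of_orthonormal_pair hT hv₁ hv hnv hv1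
      ((real_inner_comm _ _).trans hvv) ha⟩

lemma starProjection_orthogonal_add {P : Submodule ℝ R4} {x y : R4} (hx : x ∈ P) (hy : y ∈ Pᗮ) :
    Pᗮ.starProjection (x + y) = y := by
  rw [map_add, Submodule.starProjection_eq_self_iff.2 hy,
    (Submodule.starProjection_apply_eq_zero_iff _).2 (by simpa using hx), zero_add]

/-- A plane `T` inclined at the single angle `θ` to `P`: its projection to `Pᗮ` is at most one
dimensional, and the components of a vector of `T` in the directions `Pᗮ` and
`P ∩ (T ∩ P)ᗮ` are in the proportion `sin θ : cos θ`. -/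
structure IsInclined (P T : Submodule ℝ R4) (θ : ℝ) : Prop where
  exists_smul : ∃ η : R4, ∀ a ∈ T, ∃ m : ℝ, Pᗮ.starProjection a = m • η
  slope : ∀ τ ∈ T, τ ∈ P → τ ≠ 0 → ∀ n ∈ P, ‖n‖ = 1 → ⟪n, τ⟫ = 0 → ∀ a ∈ T,
    Real.sin θ * |⟪n, a⟫| = Real.cos θ * ‖Pᗮ.starProjection a‖

lemma IsInclined.mono {P T T' : Submodule ℝ R4} {θ : ℝ} (h : IsInclined P T θ) (hT : T' ≤ T) :
    IsInclined P T' θ where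
  exists_smul := let ⟨η, hη⟩ := h.exists_smul; ⟨η, fun a ha ↦ hη a (hT ha)⟩
  slope τ h1 h2 h3 n h4 h5 h6 a h7 := h.slope τ (hT h1) h2 h3 n h4 h5 h6 a (hT h7)

/-- Since `η ≠ 0`, the intersection of `T` and `P` is the line through `e`. A unit `n ∈ P`
orthogonal to it is therefore `w` or `-w`, and for `a = x • e + y • (cos θ • w + η)` the two
components have sizes `|y| cos θ` and `|y| sin θ`. The form with an absolute value avoids choosing
between these signs. -/
lemma ArePrincipalAngles.isInclined {T P : Submodule ℝ R4} {θ : ℝ}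
    (hT : Module.finrank ℝ T = 2) (hP : Module.finrank ℝ P = 2)
    (h : ArePrincipalAngles T P 0 θ) (hθ : 0 < Real.sin θ) : IsInclined P T θ := by
  have hc : 0 ≤ Real.cos θ := Real.cos_nonneg_of_neg_pi_div_two_le_of_le
    (by linarith [h.le, Real.pi_pos]) h.le_pi_div_two
  obtain ⟨e, w, η, he, hw, hη, he1, hw1, hew, hη1, -, hspan⟩ := h.exists_basis hT hP
  have hq : ∀ x y : ℝ, Pᗮ.starProjection (x • e + y • (Real.cos θ • w + η)) = y • η := by
    intro x y
    rw [smul_add, ← add_assoc]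
    exact starProjection_orthogonal_add
      (P.add_mem (P.smul_mem _ he) (P.smul_mem _ (P.smul_mem _ hw))) (Pᗮ.smul_mem _ hη)
  have hη0 : η ≠ 0 := by rw [← norm_pos_iff, hη1]; exact hθ
  refine ⟨⟨η, fun a ha ↦ ?_⟩, ?_⟩
  · obtain ⟨x, y, rfl⟩ := hspan a ha
    exact ⟨y, hq x y⟩
  · intro τ hτ hτP hτ0 n hn hn1 hnτ a ha
    obtain ⟨x, y, rfl⟩ := hspan a ha
    obtain ⟨x', y', rfl⟩ := hspan τ hτ
    have hy' : y' = 0 := by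
      have := hq x' y'
      rw [(Submodule.starProjection_apply_eq_zero_iff _).2 (by simpa using hτP)] at this
      exact (smul_eq_zero.1 this.symm).resolve_right hη0
    subst hy'
    have hx' : x' ≠ 0 := by rintro rfl; simp at hτ0
    have hne : ⟪n, e⟫ = 0 := by
      simp only [zero_smul, add_zero, inner_smul_right] at hnτ
      exact (mul_eq_zero.1 hnτ).resolve_left hx'
    have hn2 := eq_add_of_orthonormal_pair hP he hw he1 hw1 hew hn
    have hnw : |⟪n, w⟫| = 1 := by
      have := congrArg norm hn2
      rw [hne, hn1, zero_smul, zero_add, norm_smul, hw1] at this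
      simpa using this.symm
    have hnη : ⟪n, η⟫ = 0 := hη n hn
    rw [hq, norm_smul, hη1]
    simp only [inner_add_right, inner_smul_right, hne, hnη, mul_zero, zero_add, add_zero, abs_mul,
      hnw, abs_of_nonneg hc, Real.norm_eq_abs]
    ring

lemma ArePrincipalAngles.le_of_zero {T P : Submodule ℝ R4}
    (hT : Module.finrank ℝ T = 2) (hP : Module.finrank ℝ P = 2)
    (h : ArePrincipalAngles T P 0 0) : T ≤ P := by
  obtain ⟨e, w, η, he, hw, hη, he1, hw1, hew, hη1, -, hspan⟩ := h.exists_basis hT hP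
  rw [Real.sin_zero, norm_eq_zero] at hη1
  intro a ha
  obtain ⟨x, y, rfl⟩ := hspan a ha
  rw [hη1, add_zero]
  exact P.add_mem (P.smul_mem _ he) (P.smul_mem _ (P.smul_mem _ hw))

end Planes

/-! ### Parallel normal fields and holonomy tubes over a plane curve. -/

section Tubes

lemma mem_normalSpace {c : ℝ → R4} {s : ℝ} {x : R4} :
    x ∈ normalSpace c s ↔ ⟪deriv c s, x⟫ = 0 :=
  Submodule.mem_orthogonal_singleton_iff_inner_right

/-- A parallel normal field is determined by one value. -/
lemma IsNormalParallel.eqOn {c ξ ζ : ℝ → R4} {a b s₀ : ℝ} (hs₀ : s₀ ∈ Ioo a b)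
    (hξ : IsNormalParallel c (Ioo a b) ξ) (hζ : IsNormalParallel c (Ioo a b) ζ)
    (h : ξ s₀ = ζ s₀) : EqOn ξ ζ (Ioo a b) := by
  -- The difference is normal and its derivative is orthogonal to the normal space, so its squared
  -- length is constant.
  have hd : ∀ s ∈ Ioo a b, HasDerivAt (fun s ↦ ⟪ξ s - ζ s, ξ s - ζ s⟫) 0 s := by
    intro s hs
    have h1 := (hξ.differentiableAt s hs).hasDerivAt.sub (hζ.differentiableAt s hs).hasDerivAt
    have h2 := h1.inner ℝ h1
    have hn : ξ s - ζ s ∈ normalSpace c s := Submodule.sub_mem _ (hξ.normal s hs) (hζ.normal s hs)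
    have hp : deriv ξ s - deriv ζ s ∈ (normalSpace c s)ᗮ := by
      rw [← Submodule.starProjection_apply_eq_zero_iff, map_sub, hξ.parallel s hs,
        hζ.parallel s hs, sub_zero]
    have h3 : ⟪ξ s - ζ s, deriv ξ s - deriv ζ s⟫ = 0 := hp _ hn
    refine h2.congr_deriv ?_
    simp only [Pi.sub_apply]
    rw [real_inner_comm (ξ s - ζ s), h3, add_zero]
  intro s hs
  have hc := isOpen_Ioo.is_const_of_deriv_eq_zero isPreconnected_Ioo
    (fun s hs ↦ (hd s hs).differentiableAt.differentiableWithinAt) (fun s hs ↦ (hd s hs).deriv)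
    hs hs₀
  simp only [h, sub_self, inner_zero_left] at hc
  exact sub_eq_zero.1 (inner_self_eq_zero.1 hc)

lemma holonomyTube_eq {c ξ : ℝ → R4} {a b s₀ : ℝ} (hs₀ : s₀ ∈ Ioo a b)
    (hξ : IsNormalParallel c (Ioo a b) ξ) :
    holonomyTube c (Ioo a b) s₀ (ξ s₀) = (fun s ↦ c s + ξ s) '' Ioo a b := by
  ext q
  constructor
  · rintro ⟨ζ, hζ, h, s, hs, rfl⟩
    exact ⟨s, hs, by simp only [hξ.eqOn hs₀ hζ h.symm hs]⟩
  · rintro ⟨s, hs, rfl⟩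
    exact ⟨ξ, hξ, rfl, s, hs, rfl⟩

/-- By Pythagoras the hypothesis `hs` turns into `κ = cos θ * ‖κ • n + b‖`; comparing squares
suffices because `κ` and `cos θ` are nonnegative. -/
lemma angle_eq_of_slope {θ κ : ℝ} (h0 : 0 ≤ θ) (h1 : θ ≤ Real.pi / 2) {n b : R4} (hn : ‖n‖ = 1)
    (hnb : ⟪n, b⟫ = 0) (hκ : 0 ≤ κ) (hs : Real.sin θ * κ = Real.cos θ * ‖b‖)
    (hne : κ • n + b ≠ 0) : InnerProductGeometry.angle (κ • n + b) n = θ := by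
  have hc : 0 ≤ Real.cos θ := Real.cos_nonneg_of_neg_pi_div_two_le_of_le
    (by linarith [Real.pi_pos]) h1
  have hsq : ‖κ • n + b‖ ^ 2 = κ ^ 2 + ‖b‖ ^ 2 := by
    rw [norm_add_sq_real, inner_smul_left, hnb, norm_smul, hn]; simp
  have hin : ⟪κ • n + b, n⟫ = κ := by
    rw [inner_add_left, inner_smul_left, real_inner_comm n b, hnb,
      real_inner_self_eq_norm_sq, hn]; simp
  have hpos : 0 < ‖κ • n + b‖ := norm_pos_iff.2 hne
  have hκ' : κ = Real.cos θ * ‖κ • n + b‖ := by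
    refine (sq_eq_sq₀ hκ (by positivity)).1 ?_
    rw [mul_pow, hsq]
    have h2 : (Real.sin θ * κ) ^ 2 = (Real.cos θ * ‖b‖) ^ 2 := by rw [hs]
    have h3 := Real.sin_sq_add_cos_sq θ
    linear_combination h2 - κ ^ 2 * h3
  rw [InnerProductGeometry.angle, hin, hn, mul_one]
  nth_rewrite 1 [hκ']
  rw [mul_div_assoc, div_self hpos.ne', mul_one]
  exact Real.arccos_cos h0 (h1.trans (by linarith [Real.pi_pos]))

/-- The surface `c s + R t • n s + β t` is a union of holonomy tubes, if `n` is the unit normal of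
the plane curve `c`, the curve `β` is normal to the plane, and `R' : ‖β'‖ = cos θ : sin θ`. -/
lemma isUnionOfHolonomyTubes_of_eq {P : Submodule ℝ R4} (hP : Module.finrank ℝ P = 2) {θ : ℝ}
    (h0 : 0 ≤ θ) (h1 : θ ≤ Real.pi / 2) {c n β : ℝ → R4} {R κ : ℝ → ℝ} {a b s₀ a' b' : ℝ}
    (hs₀ : s₀ ∈ Ioo a b) (hab : a' < b') (hc : IsRegularCurve c (Ioo a b))
    (hcP : ∀ s ∈ Ioo a b, c s ∈ P) (hnd : DifferentiableOn ℝ n (Ioo a b))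
    (hnP : ∀ s ∈ Ioo a b, n s ∈ P) (hn1 : ∀ s ∈ Ioo a b, ‖n s‖ = 1)
    (hcn : ∀ s ∈ Ioo a b, ⟪deriv c s, n s⟫ = 0) (hβ : ContDiffOn ℝ ∞ β (Ioo a' b'))
    (hβP : ∀ t ∈ Ioo a' b', β t ∈ Pᗮ) (hR : ContDiffOn ℝ ∞ R (Ioo a' b'))
    (hRd : ∀ t ∈ Ioo a' b', HasDerivAt R (κ t) t) (hκ : ∀ t ∈ Ioo a' b', 0 ≤ κ t)
    (hslope : ∀ t ∈ Ioo a' b', Real.sin θ * κ t = Real.cos θ * ‖deriv β t‖)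
    (hreg : ∀ t ∈ Ioo a' b', κ t ≠ 0 ∨ deriv β t ≠ 0) {S : Set R4}
    (hS : S = (fun z : ℝ × ℝ ↦ c z.1 + (R z.2 • n z.1 + β z.2)) '' (Ioo a b ×ˢ Ioo a' b')) :
    IsUnionOfHolonomyTubes P θ S := by
  have hderivP : ∀ (V : Submodule ℝ R4) (g : ℝ → R4) (x y s : ℝ), s ∈ Ioo x y →
      (∀ s ∈ Ioo x y, g s ∈ V) → DifferentiableAt ℝ g s → deriv g s ∈ V := by
    intro V g x y s hs hV hg
    have h2 : (fun s ↦ Vᗮ.starProjection (g s)) =ᶠ[𝓝 s] fun _ ↦ 0 := by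
      filter_upwards [Ioo_mem_nhds hs.1 hs.2] with r hr
      exact (Submodule.starProjection_apply_eq_zero_iff _).2 (by simpa using hV r hr)
    have h3 := (Vᗮ.starProjection.hasFDerivAt.comp_hasDerivAt s hg.hasDerivAt).deriv
    have h4 := h2.deriv_eq
    rw [deriv_const] at h4
    have h5 := (Submodule.starProjection_apply_eq_zero_iff _).1 (h3.symm.trans h4)
    simpa using h5
  have hcd : ∀ s ∈ Ioo a b, DifferentiableAt ℝ c s := fun s hs ↦
    (hc.contDiffOn.differentiableOn (by simp)).differentiableAt (Ioo_mem_nhds hs.1 hs.2)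
  have hnd' : ∀ s ∈ Ioo a b, DifferentiableAt ℝ n s := fun s hs ↦
    hnd.differentiableAt (Ioo_mem_nhds hs.1 hs.2)
  have hβd : ∀ s ∈ Ioo a' b', DifferentiableAt ℝ β s := fun s hs ↦
    (hβ.differentiableOn (by simp)).differentiableAt (Ioo_mem_nhds hs.1 hs.2)
  have hcP' : ∀ s ∈ Ioo a b, deriv c s ∈ P := fun s hs ↦ hderivP P c a b s hs hcP (hcd s hs)
  have hnP' : ∀ s ∈ Ioo a b, deriv n s ∈ P := fun s hs ↦ hderivP P n a b s hs hnP (hnd' s hs)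
  have hβP' : ∀ s ∈ Ioo a' b', deriv β s ∈ Pᗮ := fun s hs ↦
    hderivP Pᗮ β a' b' s hs hβP (hβd s hs)
  have hnn : ∀ s ∈ Ioo a b, ⟪n s, deriv n s⟫ = 0 := by
    intro s hs
    have h2 := (hnd' s hs).hasDerivAt.inner ℝ (hnd' s hs).hasDerivAt
    have h3 : (fun s ↦ ⟪n s, n s⟫) =ᶠ[𝓝 s] fun _ ↦ 1 := by
      filter_upwards [Ioo_mem_nhds hs.1 hs.2] with r hr
      rw [real_inner_self_eq_norm_sq, hn1 r hr, one_pow]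
    have h4 := h2.deriv.symm.trans h3.deriv_eq
    rw [deriv_const, real_inner_comm (n s) (deriv n s)] at h4
    linarith
  have hpar : ∀ t ∈ Ioo a' b', IsNormalParallel c (Ioo a b) fun s ↦ R t • n s + β t := by
    intro t ht
    have hd : ∀ s ∈ Ioo a b, HasDerivAt (fun s ↦ R t • n s + β t) (R t • deriv n s) s := fun s hs ↦
      ((hnd' s hs).hasDerivAt.const_smul (R t)).add_const (β t)
    refine ⟨fun s hs ↦ ?_, fun s hs ↦ (hd s hs).differentiableAt, fun s hs ↦ ?_⟩
    · rw [mem_normalSpace, inner_add_right, inner_smul_right, hcn s hs,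
        (hβP t ht) _ (hcP' s hs), mul_zero, add_zero]
    · rw [(hd s hs).deriv, map_smul]
      -- In `P`, spanned by `deriv c s` and `n s`, the vector `deriv n s` is orthogonal to `n s`,
      -- hence a multiple of `deriv c s`.
      suffices (normalSpace c s).starProjection (deriv n s) = 0 by rw [this, smul_zero]
      rw [Submodule.starProjection_apply_eq_zero_iff, normalSpace,
        Submodule.orthogonal_orthogonal, Submodule.mem_span_singleton]
      have hc0 : ‖deriv c s‖ ≠ 0 := norm_ne_zero_iff.2 (hc.deriv_ne_zero s hs)
      have h2 := eq_add_of_orthonormal_pair hP (P.smul_mem ‖deriv c s‖⁻¹ (hcP' s hs)) (hnP s hs)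
        (by rw [norm_smul]; simp [hc0]) (hn1 s hs) (by rw [inner_smul_left, hcn s hs, mul_zero])
        (hnP' s hs)
      rw [real_inner_comm (n s), hnn s hs, zero_smul, add_zero, smul_smul] at h2
      exact ⟨_, h2.symm⟩
  have hγd : ∀ t ∈ Ioo a' b',
      HasDerivAt (fun t ↦ R t • n s₀ + β t) (κ t • n s₀ + deriv β t) t := fun t ht ↦
    ((hRd t ht).smul_const _).add (hβd t ht).hasDerivAt
  have hγ0 : ∀ t ∈ Ioo a' b', κ t • n s₀ + deriv β t ≠ 0 := by
    intro t ht h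
    have hin : ⟪n s₀, deriv β t⟫ = 0 := hβP' t ht _ (hnP _ hs₀)
    have h2 := congrArg (fun x ↦ ⟪n s₀, x⟫) h
    simp only [inner_add_right, inner_smul_right, hin, real_inner_self_eq_norm_sq, hn1 _ hs₀,
      inner_zero_right] at h2
    have h3 : κ t = 0 := by linarith
    rw [h3, zero_smul, zero_add] at h
    exact (hreg t ht).elim (· h3) (· h)
  refine ⟨c, fun t ↦ R t • n s₀ + β t, a, b, s₀, a', b', n s₀, hs₀, hab, hc, hcP, hnP _ hs₀,
    hn1 _ hs₀, mem_normalSpace.2 (hcn _ hs₀), fun t ht ↦ (hpar t ht).normal _ hs₀,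
    ⟨⟨(hR.smul contDiffOn_const).add hβ, fun t ht ↦ ?_⟩, fun t ht ↦ ?_⟩, ?_⟩
  · rw [(hγd t ht).deriv]
    exact hγ0 t ht
  · rw [(hγd t ht).deriv]
    exact angle_eq_of_slope h0 h1 (hn1 _ hs₀) (hβP' t ht _ (hnP _ hs₀)) (hκ t ht) (hslope t ht)
      (hγ0 t ht)
  · rw [hS]
    ext q
    simp only [mem_iUnion, exists_prop]
    constructor
    · rintro ⟨⟨s, t⟩, ⟨hs, ht⟩, rfl⟩
      exact ⟨t, ht, by rw [holonomyTube_eq hs₀ (hpar t ht)]; exact ⟨s, hs, rfl⟩⟩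
    · rintro ⟨t, ht, hq⟩
      rw [holonomyTube_eq hs₀ (hpar t ht)] at hq
      obtain ⟨s, hs, rfl⟩ := hq
      exact ⟨(s, t), ⟨hs, ht⟩, rfl⟩

end Tubes

/-! ### Coordinate squares and the inverse function theorem. -/

section Box

/-- The open square with centre `z` and half side `ε`. -/
def box (z : ℝ × ℝ) (ε : ℝ) : Set (ℝ × ℝ) := Ioo (z.1 - ε) (z.1 + ε) ×ˢ Ioo (z.2 - ε) (z.2 + ε)

lemma isOpen_box (z : ℝ × ℝ) (ε : ℝ) : IsOpen (box z ε) := isOpen_Ioo.prod isOpen_Ioo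

lemma mem_box_self (z : ℝ × ℝ) {ε : ℝ} (hε : 0 < ε) : z ∈ box z ε := by
  simp [box, hε]

lemma box_eq_ball (z : ℝ × ℝ) (ε : ℝ) : box z ε = Metric.ball z ε := by
  rw [box, ← Real.ball_eq_Ioo, ← Real.ball_eq_Ioo, ball_prod_same]

lemma exists_box_subset {z : ℝ × ℝ} {s : Set (ℝ × ℝ)} (hs : s ∈ 𝓝 z) :
    ∃ ε > 0, box z ε ⊆ s := by
  simpa only [box_eq_ball] using Metric.mem_nhds_iff.1 hs

/-- The inverse function theorem for a pair of functions on a plane. -/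
lemma exists_box_chart {E : Type*} [NormedAddCommGroup E] [NormedSpace ℝ E]
    [FiniteDimensional ℝ E] (hE : Module.finrank ℝ E = 2) {G : E → ℝ × ℝ} {Ω : Set E}
    (hΩ : IsOpen Ω) (hG : ContDiffOn ℝ ∞ G Ω) {y : E} (hy : y ∈ Ω)
    (hinj : Function.Injective (fderiv ℝ G y)) :
    ∃ (Ψ : ℝ × ℝ → E) (ε : ℝ), 0 < ε ∧ ContDiffOn ℝ ∞ Ψ (box (G y) ε) ∧ Ψ (G y) = y ∧
      MapsTo Ψ (box (G y) ε) Ω ∧ (∀ z ∈ box (G y) ε, G (Ψ z) = z) ∧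
      ∀ V ⊆ box (G y) ε, IsOpen V → IsOpen (Ψ '' V) := by
  have : CompleteSpace E := FiniteDimensional.complete ℝ E
  have hdim : Module.finrank ℝ E = Module.finrank ℝ (ℝ × ℝ) := by simp [hE]
  have hequiv : ∀ x, Function.Injective (fderiv ℝ G x) →
      ∃ A : E ≃L[ℝ] ℝ × ℝ, (A : E →L[ℝ] ℝ × ℝ) = fderiv ℝ G x := by
    intro x hx
    refine ⟨(LinearEquiv.ofInjectiveOfFinrankEq (fderiv ℝ G x).toLinearMap hx
      hdim).toContinuousLinearEquiv, ?_⟩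
    ext v <;> rfl
  obtain ⟨A, hA⟩ := hequiv y hinj
  have hcd : ∀ x ∈ Ω, ContDiffAt ℝ ∞ G x := fun x hx ↦ hG.contDiffAt (hΩ.mem_nhds hx)
  have hd : ∀ x ∈ Ω, HasFDerivAt G (fderiv ℝ G x) x := fun x hx ↦
    ((hcd x hx).differentiableAt (by simp)).hasFDerivAt
  have hcont : ContinuousAt (fderiv ℝ G) y :=
    ((hG.continuousOn_fderiv_of_isOpen hΩ (by simp)).continuousAt (hΩ.mem_nhds hy))
  -- Invertible operators form an open set, so the differential stays invertible near `y`; this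
  -- makes the inverse smooth on a whole box and not only at `G y`.
  have hnear : {x | x ∈ Ω ∧ ∃ A : E ≃L[ℝ] ℝ × ℝ, (A : E →L[ℝ] ℝ × ℝ) = fderiv ℝ G x} ∈ 𝓝 y := by
    have h1 : range ((↑) : (E ≃L[ℝ] ℝ × ℝ) → E →L[ℝ] ℝ × ℝ) ∈ 𝓝 (fderiv ℝ G y) := by
      rw [← hA]; exact ContinuousLinearEquiv.nhds A
    filter_upwards [hΩ.mem_nhds hy, hcont h1] with x hx1 hx2
    exact ⟨hx1, hx2⟩
  have hdy : HasFDerivAt G (A : E →L[ℝ] ℝ × ℝ) y := by rw [hA]; exact hd y hy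
  let e := (hcd y hy).toOpenPartialHomeomorph G hdy (by simp)
  have he : ∀ x, e x = G x := fun x ↦ rfl
  have hye : y ∈ e.source := (hcd y hy).mem_toOpenPartialHomeomorph_source hdy (by simp)
  have hGy : G y ∈ e.target := e.map_source hye
  have hsymm : e.symm (G y) = y := e.left_inv hye
  have hpre : e.symm ⁻¹' {x | x ∈ Ω ∧ ∃ A : E ≃L[ℝ] ℝ × ℝ,
      (A : E →L[ℝ] ℝ × ℝ) = fderiv ℝ G x} ∈ 𝓝 (G y) := by
    refine (e.symm.continuousAt hGy) ?_
    rw [hsymm]; exact hnear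
  obtain ⟨ε, hε, hbox⟩ := exists_box_subset (Filter.inter_mem hpre (e.open_target.mem_nhds hGy))
  refine ⟨e.symm, ε, hε, fun z hz ↦ ?_, hsymm, fun z hz ↦ (hbox hz).1.1,
    fun z hz ↦ e.right_inv (hbox hz).2, fun V hV hVo ↦ ?_⟩
  · obtain ⟨⟨h1, A', hA'⟩, h2⟩ := hbox hz
    refine (e.contDiffAt_symm h2 (f₀' := A') ?_ (hcd _ h1)).contDiffWithinAt
    rw [hA']
    exact hd _ h1
  · exact e.symm.isOpen_image_of_subset_source hVo fun z hz ↦ (hbox (hV hz)).2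

lemma fderiv_injective_of_leftInverse {E F : Type*} [NormedAddCommGroup E] [NormedSpace ℝ E]
    [NormedAddCommGroup F] [NormedSpace ℝ F] {G : E → F} {Ψ : F → E} {B : Set F} (hB : IsOpen B)
    (h : ∀ z ∈ B, G (Ψ z) = z) {z : F} (hz : z ∈ B) (hG : DifferentiableAt ℝ G (Ψ z))
    (hΨ : DifferentiableAt ℝ Ψ z) : ∀ v, fderiv ℝ G (Ψ z) (fderiv ℝ Ψ z v) = v := by
  intro v
  have h1 := (hG.hasFDerivAt.comp z hΨ.hasFDerivAt).fderiv
  have h2 : G ∘ Ψ =ᶠ[𝓝 z] id := by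
    filter_upwards [hB.mem_nhds hz] with x hx using h x hx
  rw [h2.fderiv_eq, fderiv_id] at h1
  exact (congrArg (· v) h1).symm

end Box

/-! ### Partial derivatives on a box, and primitives. -/

section Partial

variable {V : Type*} [NormedAddCommGroup V] [NormedSpace ℝ V]

lemma hasDerivAt_fst {g : ℝ × ℝ → V} {x y : ℝ} (hg : DifferentiableAt ℝ g (x, y)) :
    HasDerivAt (fun s ↦ g (s, y)) (fderiv ℝ g (x, y) (1, 0)) x :=
  hg.hasFDerivAt.comp_hasDerivAt x ((hasDerivAt_id x).prodMk (hasDerivAt_const x y))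

lemma hasDerivAt_snd {g : ℝ × ℝ → V} {x y : ℝ} (hg : DifferentiableAt ℝ g (x, y)) :
    HasDerivAt (fun t ↦ g (x, t)) (fderiv ℝ g (x, y) (0, 1)) y :=
  hg.hasFDerivAt.comp_hasDerivAt y ((hasDerivAt_const y x).prodMk (hasDerivAt_id y))

lemma fderiv_apply_eq_smul_add_smul (g : ℝ × ℝ → V) (z v : ℝ × ℝ) :
    fderiv ℝ g z v = v.1 • fderiv ℝ g z (1, 0) + v.2 • fderiv ℝ g z (0, 1) := by
  rw [← map_smul, ← map_smul, ← map_add]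
  congr 1
  ext <;> simp

lemma eq_of_fderiv_fst_eq_zero {g : ℝ × ℝ → V} {z₀ : ℝ × ℝ} {ε : ℝ}
    (hg : DifferentiableOn ℝ g (box z₀ ε)) (h : ∀ z ∈ box z₀ ε, fderiv ℝ g z (1, 0) = 0)
    {z : ℝ × ℝ} (hz : z ∈ box z₀ ε) {x : ℝ} (hx : x ∈ Ioo (z₀.1 - ε) (z₀.1 + ε)) :
    g z = g (x, z.2) := by
  have hd : ∀ s ∈ Ioo (z₀.1 - ε) (z₀.1 + ε), HasDerivAt (fun s ↦ g (s, z.2)) 0 s := fun s hs ↦ by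
    have hsz : (s, z.2) ∈ box z₀ ε := ⟨hs, hz.2⟩
    rw [← h _ hsz]
    exact hasDerivAt_fst (hg.differentiableAt ((isOpen_box _ _).mem_nhds hsz))
  exact isOpen_Ioo.is_const_of_deriv_eq_zero isPreconnected_Ioo
    (fun s hs ↦ (hd s hs).differentiableAt.differentiableWithinAt) (fun s hs ↦ (hd s hs).deriv)
    hz.1 hx

lemma eq_of_fderiv_snd_eq_zero {g : ℝ × ℝ → V} {z₀ : ℝ × ℝ} {ε : ℝ}
    (hg : DifferentiableOn ℝ g (box z₀ ε)) (h : ∀ z ∈ box z₀ ε, fderiv ℝ g z (0, 1) = 0)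
    {z : ℝ × ℝ} (hz : z ∈ box z₀ ε) {y : ℝ} (hy : y ∈ Ioo (z₀.2 - ε) (z₀.2 + ε)) :
    g z = g (z.1, y) := by
  have hd : ∀ t ∈ Ioo (z₀.2 - ε) (z₀.2 + ε), HasDerivAt (fun t ↦ g (z.1, t)) 0 t := fun t ht ↦ by
    have hsz : (z.1, t) ∈ box z₀ ε := ⟨hz.1, ht⟩
    rw [← h _ hsz]
    exact hasDerivAt_snd (hg.differentiableAt ((isOpen_box _ _).mem_nhds hsz))
  exact isOpen_Ioo.is_const_of_deriv_eq_zero isPreconnected_Ioo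
    (fun s hs ↦ (hd s hs).differentiableAt.differentiableWithinAt) (fun s hs ↦ (hd s hs).deriv)
    hz.2 hy

lemma exists_primitive {κ : ℝ → ℝ} {a b t₀ : ℝ} (hκ : ContDiffOn ℝ ∞ κ (Ioo a b))
    (ht₀ : t₀ ∈ Ioo a b) :
    ∃ R : ℝ → ℝ, R t₀ = 0 ∧ (∀ t ∈ Ioo a b, HasDerivAt R (κ t) t) ∧
      ContDiffOn ℝ ∞ R (Ioo a b) := by
  have hd : ∀ t ∈ Ioo a b, HasDerivAt (fun u ↦ ∫ x in t₀..u, κ x) (κ t) t := fun t ht ↦ by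
    have hsub : uIcc t₀ t ⊆ Ioo a b := ordConnected_Ioo.uIcc_subset ht₀ ht
    exact intervalIntegral.integral_hasDerivAt_right
      (hκ.continuousOn.mono hsub).intervalIntegrable
      (hκ.continuousOn.stronglyMeasurableAtFilter isOpen_Ioo t ht)
      (hκ.continuousOn.continuousAt (isOpen_Ioo.mem_nhds ht))
  refine ⟨fun u ↦ ∫ x in t₀..u, κ x, intervalIntegral.integral_same, hd, ?_⟩
  refine (contDiffOn_infty_iff_deriv_of_isOpen isOpen_Ioo).2
    ⟨fun t ht ↦ (hd t ht).differentiableAt.differentiableWithinAt,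
      hκ.congr fun t ht ↦ (hd t ht).deriv⟩

end Partial

/-! ### The transport equation for the unit normal. -/

section Frame

lemma fderiv_mem_of_mem {E : Type*} [NormedAddCommGroup E] [NormedSpace ℝ E] {g : E → R4}
    {P : Submodule ℝ R4} {B : Set E} (hB : IsOpen B) (hgP : ∀ z ∈ B, g z ∈ P) {z : E}
    (hz : z ∈ B) (hg : DifferentiableAt ℝ g z) (v : E) : fderiv ℝ g z v ∈ P := by
  have h1 := (Pᗮ.starProjection.hasFDerivAt.comp z hg.hasFDerivAt).fderiv
  have h2 : Pᗮ.starProjection ∘ g =ᶠ[𝓝 z] fun _ ↦ 0 := by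
    filter_upwards [hB.mem_nhds hz] with x hx
    exact (Submodule.starProjection_apply_eq_zero_iff _).2 (by simpa using hgP x hx)
  rw [h2.fderiv_eq, fderiv_const_apply] at h1
  have h3 : Pᗮ.starProjection (fderiv ℝ g z v) = 0 := (congrArg (· v) h1).symm
  simpa using (Submodule.starProjection_apply_eq_zero_iff _).1 h3

/-- The second order identity behind the theorem: if `u` is a map to a plane, `N` is the unit
normal of its `s`-curves and `⟪N, ∂ₜu⟫` depends on `t` only, then the vector field along which
`u` moves in the direction `N` leaves `N` invariant. -/
lemma exists_transport {P : Submodule ℝ R4} (hP : Module.finrank ℝ P = 2) {u N : ℝ × ℝ → R4}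
    {κ : ℝ → ℝ} {B : Set (ℝ × ℝ)} (hB : IsOpen B) (hu : ContDiffOn ℝ ∞ u B)
    (hN : ContDiffOn ℝ ∞ N B) (huP : ∀ z ∈ B, u z ∈ P) (hNP : ∀ z ∈ B, N z ∈ P)
    (hN1 : ∀ z ∈ B, ‖N z‖ = 1) (hS : ∀ z ∈ B, fderiv ℝ u z (1, 0) ≠ 0)
    (hNS : ∀ z ∈ B, ⟪N z, fderiv ℝ u z (1, 0)⟫ = 0)
    (hNT : ∀ z ∈ B, ⟪N z, fderiv ℝ u z (0, 1)⟫ = κ z.2)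
    (hκ : ∀ z ∈ B, DifferentiableAt ℝ κ z.2) {z : ℝ × ℝ} (hz : z ∈ B) :
    ∃ a : ℝ, fderiv ℝ u z (0, 1) = a • fderiv ℝ u z (1, 0) + κ z.2 • N z ∧
      fderiv ℝ N z (0, 1) = a • fderiv ℝ N z (1, 0) := by
  have hzn := hB.mem_nhds hz
  have hud : DifferentiableAt ℝ u z := (hu.contDiffAt hzn).differentiableAt (by simp)
  have hNd : DifferentiableAt ℝ N z := (hN.contDiffAt hzn).differentiableAt (by simp)
  have hu' : DifferentiableAt ℝ (fderiv ℝ u) z :=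
    ((hu.fderiv_of_isOpen hB (m := ∞) (by simp)).contDiffAt hzn).differentiableAt (by simp)
  have hpd : ∀ v : ℝ × ℝ, HasFDerivAt (fun x ↦ fderiv ℝ u x v)
      ((ContinuousLinearMap.apply ℝ R4 v).comp (fderiv ℝ (fderiv ℝ u) z)) z := fun v ↦
    (ContinuousLinearMap.apply ℝ R4 v).hasFDerivAt.comp z hu'.hasFDerivAt
  have hsymm : fderiv ℝ (fderiv ℝ u) z (0, 1) (1, 0) = fderiv ℝ (fderiv ℝ u) z (1, 0) (0, 1) :=
    ((contDiffOn_infty.1 hu 2).contDiffAt hzn).isSymmSndFDerivAt (by simp) _ _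
  set S := fderiv ℝ u z (1, 0) with hSdef
  set T := fderiv ℝ u z (0, 1) with hTdef
  have hSP : S ∈ P := fderiv_mem_of_mem hB huP hz hud _
  have hTP : T ∈ P := fderiv_mem_of_mem hB huP hz hud _
  have hS0 : ‖S‖ ≠ 0 := norm_ne_zero_iff.2 (hS z hz)
  have hexp : ∀ x ∈ P, x = (⟪x, S⟫ / ‖S‖ ^ 2) • S + ⟪x, N z⟫ • N z := by
    intro x hx
    have h := eq_add_of_orthonormal_pair hP (P.smul_mem ‖S‖⁻¹ hSP) (hNP z hz)
      (by rw [norm_smul]; simp [hS0]) (hN1 z hz)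
      (by rw [inner_smul_left, real_inner_comm, hNS z hz, mul_zero]) hx
    rw [inner_smul_right, smul_smul] at h
    convert h using 3
    field_simp
  have hTe := hexp T hTP
  rw [real_inner_comm (N z) T, show ⟪N z, T⟫ = κ z.2 from hNT z hz] at hTe
  have hNN : ∀ v, ⟪fderiv ℝ N z v, N z⟫ = 0 := by
    intro v
    have h1 := fderiv_inner_apply ℝ hNd hNd v
    have h2 : (fun x ↦ ⟪N x, N x⟫) =ᶠ[𝓝 z] fun _ ↦ 1 := by
      filter_upwards [hzn] with x hx
      rw [real_inner_self_eq_norm_sq, hN1 x hx, one_pow]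
    rw [h2.fderiv_eq, fderiv_const_apply, real_inner_comm (fderiv ℝ N z v)] at h1
    simp only [zero_apply] at h1
    linarith
  have hNSd : ⟪N z, fderiv ℝ (fderiv ℝ u) z (0, 1) (1, 0)⟫ + ⟪fderiv ℝ N z (0, 1), S⟫ = 0 := by
    have h1 := fderiv_inner_apply ℝ hNd (hpd (1, 0)).differentiableAt (0, 1)
    have h2 : (fun x ↦ ⟪N x, fderiv ℝ u x (1, 0)⟫) =ᶠ[𝓝 z] fun _ ↦ 0 := by
      filter_upwards [hzn] with x hx using hNS x hx
    rw [h2.fderiv_eq, fderiv_const_apply, (hpd (1, 0)).fderiv] at h1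
    exact h1.symm
  have hNTd : ⟪N z, fderiv ℝ (fderiv ℝ u) z (1, 0) (0, 1)⟫ + ⟪fderiv ℝ N z (1, 0), T⟫ = 0 := by
    have h1 := fderiv_inner_apply ℝ hNd (hpd (0, 1)).differentiableAt (1, 0)
    have h2 : (fun x ↦ ⟪N x, fderiv ℝ u x (0, 1)⟫) =ᶠ[𝓝 z] fun x ↦ κ x.2 := by
      filter_upwards [hzn] with x hx using hNT x hx
    have h3 : HasFDerivAt (fun x : ℝ × ℝ ↦ κ x.2) _ z :=
      (hκ z hz).hasFDerivAt.comp z hasFDerivAt_snd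
    rw [h2.fderiv_eq, h3.fderiv, (hpd (0, 1)).fderiv] at h1
    simp only [ContinuousLinearMap.comp_apply, ContinuousLinearMap.coe_snd', map_zero] at h1
    exact h1.symm
  refine ⟨⟪T, S⟫ / ‖S‖ ^ 2, hTe, ?_⟩
  have hN'P := fun v ↦ fderiv_mem_of_mem hB hNP hz hNd v
  have e1 := hexp _ (hN'P (0, 1))
  have e2 := hexp _ (hN'P (1, 0))
  rw [hNN, zero_smul, add_zero] at e1 e2
  -- Subtracting the `t`-derivative of `⟪N, ∂ₛu⟫ = 0` and the `s`-derivative of `⟪N, ∂ₜu⟫ = κ t`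
  -- cancels the mixed partials and leaves `⟪∂ₜN, S⟫ = ⟪∂ₛN, T⟫`. The `N`-part of `T` does not
  -- contribute, as `∂ₛN` is orthogonal to `N`.
  have key : ⟪fderiv ℝ N z (0, 1), S⟫ = ⟪T, S⟫ / ‖S‖ ^ 2 * ⟪fderiv ℝ N z (1, 0), S⟫ := by
    rw [hsymm] at hNSd
    rw [hTe, inner_add_right, inner_smul_right, inner_smul_right, hNN] at hNTd
    linarith
  rw [e1, e2, smul_smul]
  congr 1
  rw [key]
  ring

end Frame

/-! ### Straightening the transport field. -/

section Frame

/-- With `a` from `exists_transport`, the term `κ • N` in `∂ₜu` cancels against the derivative of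
`R`, so both `w = u - R • N` and `N` are annihilated by `∂ₜ - a ∂ₛ`. A first coordinate that is a
function of `w`, together with `t`, straightens this field without solving an ODE; in the new chart
`w` and `N` depend on the first coordinate only and become the base curve and its normal. -/
lemma exists_isUnionOfHolonomyTubes_of_frame {P : Submodule ℝ R4}
    (hP : Module.finrank ℝ P = 2) {θ : ℝ} (h0 : 0 ≤ θ) (h1 : θ ≤ Real.pi / 2)
    {u N : ℝ × ℝ → R4} {β : ℝ → R4} {κ : ℝ → ℝ} {z₀ : ℝ × ℝ} {ε : ℝ} (hε : 0 < ε)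
    (hu : ContDiffOn ℝ ∞ u (box z₀ ε)) (hN : ContDiffOn ℝ ∞ N (box z₀ ε))
    (huP : ∀ z ∈ box z₀ ε, u z ∈ P) (hNP : ∀ z ∈ box z₀ ε, N z ∈ P)
    (hN1 : ∀ z ∈ box z₀ ε, ‖N z‖ = 1) (hS : ∀ z ∈ box z₀ ε, fderiv ℝ u z (1, 0) ≠ 0)
    (hNS : ∀ z ∈ box z₀ ε, ⟪N z, fderiv ℝ u z (1, 0)⟫ = 0)
    (hNT : ∀ z ∈ box z₀ ε, ⟪N z, fderiv ℝ u z (0, 1)⟫ = κ z.2)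
    (hβ : ContDiffOn ℝ ∞ β (Ioo (z₀.2 - ε) (z₀.2 + ε)))
    (hβP : ∀ t ∈ Ioo (z₀.2 - ε) (z₀.2 + ε), β t ∈ Pᗮ)
    (hκs : ContDiffOn ℝ ∞ κ (Ioo (z₀.2 - ε) (z₀.2 + ε)))
    (hκ : ∀ t ∈ Ioo (z₀.2 - ε) (z₀.2 + ε), 0 ≤ κ t)
    (hslope : ∀ t ∈ Ioo (z₀.2 - ε) (z₀.2 + ε), Real.sin θ * κ t = Real.cos θ * ‖deriv β t‖)
    (hreg : ∀ t ∈ Ioo (z₀.2 - ε) (z₀.2 + ε), κ t ≠ 0 ∨ deriv β t ≠ 0) :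
    ∃ U ⊆ box z₀ ε, IsOpen U ∧ z₀ ∈ U ∧
      IsUnionOfHolonomyTubes P θ ((fun z ↦ u z + β z.2) '' U) := by
  have hB := isOpen_box z₀ ε
  have hz₀ := mem_box_self z₀ hε
  -- The primitive vanishes at `z₀.2`, so that `w` and `u` agree on the line `t = z₀.2`. There `∂ₛw
  -- = ∂ₛu`, which is nonzero and orthogonal to `N`; the base curve is read off on this line.
  obtain ⟨R, hR0, hRd, hR⟩ := exists_primitive hκs hz₀.2
  have hud : ∀ z ∈ box z₀ ε, DifferentiableAt ℝ u z := fun z hz ↦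
    (hu.contDiffAt (hB.mem_nhds hz)).differentiableAt (by simp)
  have hNd : ∀ z ∈ box z₀ ε, DifferentiableAt ℝ N z := fun z hz ↦
    (hN.contDiffAt (hB.mem_nhds hz)).differentiableAt (by simp)
  have hκd : ∀ z ∈ box z₀ ε, DifferentiableAt ℝ κ z.2 := fun z hz ↦
    (hκs.contDiffAt (isOpen_Ioo.mem_nhds hz.2)).differentiableAt (by simp)
  let w : ℝ × ℝ → R4 := fun z ↦ u z - R z.2 • N z
  have hw : ContDiffOn ℝ ∞ w (box z₀ ε) :=
    hu.sub ((hR.comp contDiffOn_snd fun z hz ↦ hz.2).smul hN)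
  have hwd : ∀ z ∈ box z₀ ε, DifferentiableAt ℝ w z := fun z hz ↦
    (hw.contDiffAt (hB.mem_nhds hz)).differentiableAt (by simp)
  have hw' : ∀ z ∈ box z₀ ε, ∀ v, fderiv ℝ w z v =
      fderiv ℝ u z v - (R z.2 • fderiv ℝ N z v + (v.2 * κ z.2) • N z) := by
    intro z hz v
    have h2 : HasFDerivAt (fun x : ℝ × ℝ ↦ R x.2) _ z :=
      (hRd _ hz.2).hasFDerivAt.comp z hasFDerivAt_snd
    have h3 : HasFDerivAt w _ z := (hud z hz).hasFDerivAt.sub (h2.smul (hNd z hz).hasFDerivAt)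
    rw [h3.fderiv]
    simp
  have hws : ∀ z ∈ box z₀ ε, R z.2 = 0 →
      fderiv ℝ w z (1, 0) = fderiv ℝ u z (1, 0) := by
    intro z hz hRz
    rw [hw' z hz, hRz]
    simp
  have htrans : ∀ z ∈ box z₀ ε, ∃ a : ℝ, fderiv ℝ w z (0, 1) = a • fderiv ℝ w z (1, 0) ∧
      fderiv ℝ N z (0, 1) = a • fderiv ℝ N z (1, 0) := by
    intro z hz
    obtain ⟨a, ha1, ha2⟩ := exists_transport hP hB hu hN huP hNP hN1 hS hNS hNT hκd hz
    refine ⟨a, ?_, ha2⟩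
    rw [hw' z hz, hw' z hz, ha1, ha2]
    module
  let e := fderiv ℝ u z₀ (1, 0)
  -- Since `∂ₛw = e` at `z₀`, the first coordinate has `s`-derivative `‖e‖ ^ 2 ≠ 0` there.
  let G : ℝ × ℝ → ℝ × ℝ := fun z ↦ (⟪e, w z⟫, z.2)
  have hG : ContDiffOn ℝ ∞ G (box z₀ ε) := (contDiffOn_const.inner ℝ hw).prodMk contDiffOn_snd
  have hG' : ∀ z ∈ box z₀ ε, ∀ v, fderiv ℝ G z v = (⟪e, fderiv ℝ w z v⟫, v.2) := by
    intro z hz v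
    have h2 : HasFDerivAt (fun x ↦ ⟪e, w x⟫) ((innerSL ℝ e).comp (fderiv ℝ w z)) z :=
      (innerSL ℝ e).hasFDerivAt.comp z (hwd z hz).hasFDerivAt
    rw [(h2.prodMk hasFDerivAt_snd).fderiv]
    simp
  have hGd : ∀ z ∈ box z₀ ε, DifferentiableAt ℝ G z := fun z hz ↦
    (hG.contDiffAt (hB.mem_nhds hz)).differentiableAt (by simp)
  let Ω := {z | z ∈ box z₀ ε ∧ ⟪e, fderiv ℝ w z (1, 0)⟫ ≠ 0}
  have hΩ : IsOpen Ω := by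
    have hc : ContinuousOn (fun z ↦ ⟪e, fderiv ℝ w z (1, 0)⟫) (box z₀ ε) :=
      continuousOn_const.inner ((hw.continuousOn_fderiv_of_isOpen hB (by simp)).clm_apply
        continuousOn_const)
    exact hc.isOpen_inter_preimage hB isOpen_ne
  have hΩ₀ : z₀ ∈ Ω := by
    refine ⟨hz₀, ?_⟩
    rw [hws z₀ hz₀ hR0]
    exact fun h ↦ hS z₀ hz₀ (inner_self_eq_zero.1 h)
  have hinj : Function.Injective (fderiv ℝ G z₀) := by
    rw [injective_iff_map_eq_zero]
    intro v hv
    rw [hG' z₀ hz₀, Prod.mk_eq_zero] at hv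
    obtain ⟨hv1, hv2⟩ := hv
    rw [fderiv_apply_eq_smul_add_smul, hv2, zero_smul, add_zero, inner_smul_right] at hv1
    exact Prod.ext ((mul_eq_zero.1 hv1).resolve_right hΩ₀.2) hv2
  obtain ⟨Ψ, δ, hδ, hΨ, hΨ₀, hΨΩ, hGΨ, hopen⟩ := exists_box_chart (by simp) hΩ
    (hG.mono fun z hz ↦ hz.1) hΩ₀ hinj
  set g₀ := G z₀ with hg₀
  have hB' := isOpen_box g₀ δ
  have hg₀' := mem_box_self g₀ hδ
  have hΨB : ∀ z ∈ box g₀ δ, Ψ z ∈ box z₀ ε := fun z hz ↦ (hΨΩ hz).1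
  have hΨd : ∀ z ∈ box g₀ δ, DifferentiableAt ℝ Ψ z := fun z hz ↦
    (hΨ.contDiffAt (hB'.mem_nhds hz)).differentiableAt (by simp)
  have hΨ2 : ∀ z ∈ box g₀ δ, (Ψ z).2 = z.2 := fun z hz ↦ (Prod.ext_iff.1 (hGΨ z hz)).2
  have hK : ∀ t ∈ Ioo (g₀.2 - δ) (g₀.2 + δ), t ∈ Ioo (z₀.2 - ε) (z₀.2 + ε) := by
    intro t ht
    have hz : (g₀.1, t) ∈ box g₀ δ := ⟨hg₀'.1, ht⟩
    have := (hΨB _ hz).2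
    rwa [hΨ2 _ hz] at this
  have hGΨ' : ∀ z ∈ box g₀ δ, ∀ v, fderiv ℝ G (Ψ z) (fderiv ℝ Ψ z v) = v := fun z hz ↦
    fderiv_injective_of_leftInverse hB' hGΨ hz (hGd _ (hΨB z hz)) (hΨd z hz)
  have hΨ' : ∀ z ∈ box g₀ δ, ∀ v, (fderiv ℝ Ψ z v).2 = v.2 ∧
      ⟪e, fderiv ℝ w (Ψ z) (fderiv ℝ Ψ z v)⟫ = v.1 := by
    intro z hz v
    have h2 := hGΨ' z hz v
    rw [hG' _ (hΨB z hz)] at h2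
    exact ⟨(Prod.ext_iff.1 h2).2, (Prod.ext_iff.1 h2).1⟩
  -- The second coordinate vector of the chart `Ψ` has the form `(b, 1)` and leaves `⟪e, w⟫` fixed.
  -- Hence `(b + a) * ⟪e, ∂ₛw⟫ = 0`, and the definition of `Ω` gives `b = -a`: it is the transport
  -- field.
  have hvert : ∀ z ∈ box g₀ δ, fderiv ℝ w (Ψ z) (fderiv ℝ Ψ z (0, 1)) = 0 ∧
      fderiv ℝ N (Ψ z) (fderiv ℝ Ψ z (0, 1)) = 0 := by
    intro z hz
    obtain ⟨a, ha1, ha2⟩ := htrans _ (hΨB z hz)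
    obtain ⟨h2, h3⟩ := hΨ' z hz (0, 1)
    simp only at h2 h3
    rw [fderiv_apply_eq_smul_add_smul, h2, ha1, one_smul, ← add_smul, inner_smul_right] at h3
    have h4 := (mul_eq_zero.1 h3).resolve_right (hΨΩ hz).2
    rw [fderiv_apply_eq_smul_add_smul w, fderiv_apply_eq_smul_add_smul N, h2, ha1, ha2, one_smul,
      one_smul, ← add_smul, ← add_smul, h4, zero_smul, zero_smul]
    exact ⟨rfl, rfl⟩
  have hcomp : ∀ g : ℝ × ℝ → R4, ContDiffOn ℝ ∞ g (box z₀ ε) →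
      (∀ z ∈ box g₀ δ, fderiv ℝ g (Ψ z) (fderiv ℝ Ψ z (0, 1)) = 0) →
      ∀ z ∈ box g₀ δ, g (Ψ z) = g (Ψ (z.1, z₀.2)) := by
    intro g hg hg0 z hz
    refine eq_of_fderiv_snd_eq_zero (g := fun z ↦ g (Ψ z)) (z₀ := g₀) (ε := δ)
      ((hg.comp hΨ hΨB).differentiableOn (by simp)) (fun z hz ↦ ?_) hz (y := z₀.2) hg₀'.2
    rw [← hg0 z hz]
    have h2 : HasFDerivAt (fun z ↦ g (Ψ z)) _ z :=
      ((hg.contDiffAt (hB.mem_nhds (hΨB z hz))).differentiableAt (by simp)).hasFDerivAt.comp z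
        (hΨd z hz).hasFDerivAt
    rw [h2.fderiv]
    rfl
  have hline : ∀ s ∈ Ioo (g₀.1 - δ) (g₀.1 + δ), (s, z₀.2) ∈ box g₀ δ := fun s hs ↦ ⟨hs, hg₀'.2⟩
  have hΨline : ContDiffOn ℝ ∞ (fun s ↦ Ψ (s, z₀.2)) (Ioo (g₀.1 - δ) (g₀.1 + δ)) :=
    hΨ.comp (contDiffOn_id.prodMk contDiffOn_const) hline
  have hc' : ∀ s ∈ Ioo (g₀.1 - δ) (g₀.1 + δ), deriv (fun s ↦ w (Ψ (s, z₀.2))) s =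
      fderiv ℝ w (Ψ (s, z₀.2)) (fderiv ℝ Ψ (s, z₀.2) (1, 0)) := fun s hs ↦
    HasDerivAt.deriv (f := w ∘ fun s ↦ Ψ (s, z₀.2))
      ((hwd _ (hΨB _ (hline s hs))).hasFDerivAt.comp_hasDerivAt s
        (hasDerivAt_fst (hΨd _ (hline s hs))))
  refine ⟨Ψ '' box g₀ δ, ?_, hopen _ subset_rfl hB', ⟨g₀, hg₀', hΨ₀⟩,
    isUnionOfHolonomyTubes_of_eq hP h0 h1 (c := fun s ↦ w (Ψ (s, z₀.2)))
      (n := fun s ↦ N (Ψ (s, z₀.2))) (β := β) (R := R) (κ := κ) (a := g₀.1 - δ) (b := g₀.1 + δ)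
      (a' := g₀.2 - δ) (b' := g₀.2 + δ) (s₀ := g₀.1) hg₀'.1 (by linarith) ⟨?_, fun s hs h ↦ ?_⟩
      (fun s hs ↦ ?_) ?_ (fun s hs ↦ hNP _ (hΨB _ (hline s hs)))
      (fun s hs ↦ hN1 _ (hΨB _ (hline s hs))) (fun s hs ↦ ?_) (hβ.mono hK)
      (fun t ht ↦ hβP t (hK t ht)) (hR.mono hK) (fun t ht ↦ hRd t (hK t ht))
      (fun t ht ↦ hκ t (hK t ht)) (fun t ht ↦ hslope t (hK t ht))
      (fun t ht ↦ hreg t (hK t ht)) ?_⟩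
  · rintro _ ⟨z, hz, rfl⟩
    exact hΨB z hz
  · exact hw.comp hΨline fun s hs ↦ hΨB _ (hline s hs)
  · have h2 := (hΨ' _ (hline s hs) (1, 0)).2
    rw [← hc' s hs, h, inner_zero_right] at h2
    exact zero_ne_one h2
  · have hz := hΨB _ (hline s hs)
    exact P.sub_mem (huP _ hz) (P.smul_mem _ (hNP _ hz))
  · exact (hN.comp hΨline fun s hs ↦ hΨB _ (hline s hs)).differentiableOn (by simp)
  · have hz := hΨB _ (hline s hs)
    rw [hc' s hs, fderiv_apply_eq_smul_add_smul, (hΨ' _ (hline s hs) (1, 0)).1,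
      hws _ hz (by rw [hΨ2 _ (hline s hs)]; exact hR0), zero_smul, add_zero, inner_smul_left,
      real_inner_comm, hNS _ hz, mul_zero]
  · rw [image_image]
    refine image_congr fun z hz ↦ ?_
    rw [← hcomp w hw (fun z hz ↦ (hvert z hz).1) z hz,
      ← hcomp N hN (fun z hz ↦ (hvert z hz).2) z hz, hΨ2 z hz, ← hΨ2 z hz]
    simp only [w]
    abel

end Frame

/-! ### The local theorem for `θ > 0` and for `θ = 0`. -/

section Local

lemma inner_starProjection_of_mem {K : Submodule ℝ R4} {x y : R4} (hx : x ∈ K) :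
    ⟪x, K.starProjection y⟫ = ⟪x, y⟫ := by
  rw [← Submodule.inner_starProjection_left_eq_right, Submodule.starProjection_eq_self_iff.2 hx]

/-- Derives the frame data from the inclination: with the height over `P` as second coordinate, the
`Pᗮ`-component depends on `t` alone, `∂ₛF` spans the direction shared with `P`, and the slope
relation prescribes the normal speed of the level curves. -/
lemma exists_isUnionOfHolonomyTubes_of_box {P : Submodule ℝ R4}
    (hP : Module.finrank ℝ P = 2) {θ : ℝ} (h0 : 0 ≤ θ) (h1 : θ ≤ Real.pi / 2)
    (hθ : 0 < Real.sin θ) {F : ℝ × ℝ → R4} {z₀ : ℝ × ℝ} {ε : ℝ} (hε : 0 < ε)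
    (hF : ContDiffOn ℝ ∞ F (box z₀ ε))
    (hinj : ∀ z ∈ box z₀ ε, Function.Injective (fderiv ℝ F z))
    (hinc : ∀ z ∈ box z₀ ε, IsInclined P (LinearMap.range (fderiv ℝ F z).toLinearMap) θ)
    {e : R4} (heP : e ∈ Pᗮ) (he : ∀ z ∈ box z₀ ε, ⟪e, F z⟫ = z.2) :
    ∃ U ⊆ box z₀ ε, IsOpen U ∧ z₀ ∈ U ∧ IsUnionOfHolonomyTubes P θ (F '' U) := by
  have hc0 : 0 ≤ Real.cos θ := Real.cos_nonneg_of_neg_pi_div_two_le_of_le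
    (by linarith [Real.pi_pos]) h1
  have hB := isOpen_box z₀ ε
  have hz₀ := mem_box_self z₀ hε
  have hFd : ∀ z ∈ box z₀ ε, DifferentiableAt ℝ F z := fun z hz ↦
    (hF.contDiffAt (hB.mem_nhds hz)).differentiableAt (by simp)
  let u : ℝ × ℝ → R4 := fun z ↦ P.starProjection (F z)
  let v : ℝ × ℝ → R4 := fun z ↦ Pᗮ.starProjection (F z)
  have huv : ∀ z, u z + v z = F z := fun z ↦
    P.starProjection_add_starProjection_orthogonal (F z)
  have hu : ContDiffOn ℝ ∞ u (box z₀ ε) := P.starProjection.contDiff.comp_contDiffOn hF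
  have hv : ContDiffOn ℝ ∞ v (box z₀ ε) := Pᗮ.starProjection.contDiff.comp_contDiffOn hF
  have hu' : ∀ z ∈ box z₀ ε, ∀ x, fderiv ℝ u z x = P.starProjection (fderiv ℝ F z x) :=
    fun z hz x ↦ congrArg (· x) (P.starProjection.hasFDerivAt.comp z (hFd z hz).hasFDerivAt).fderiv
  have hv' : ∀ z ∈ box z₀ ε, ∀ x, fderiv ℝ v z x = Pᗮ.starProjection (fderiv ℝ F z x) :=
    fun z hz x ↦
      congrArg (· x) (Pᗮ.starProjection.hasFDerivAt.comp z (hFd z hz).hasFDerivAt).fderiv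
  have he' : ∀ z ∈ box z₀ ε, ∀ x, ⟪e, fderiv ℝ v z x⟫ = x.2 := by
    intro z hz x
    rw [hv' z hz, inner_starProjection_of_mem heP]
    have h2 : HasFDerivAt (fun z ↦ ⟪e, F z⟫) ((innerSL ℝ e).comp (fderiv ℝ F z)) z :=
      (innerSL ℝ e).hasFDerivAt.comp z (hFd z hz).hasFDerivAt
    have h3 : (fun z ↦ ⟪e, F z⟫) =ᶠ[𝓝 z] Prod.snd := by
      filter_upwards [hB.mem_nhds hz] with y hy using he y hy
    have h4 := h2.fderiv.symm.trans (h3.fderiv_eq.trans hasFDerivAt_snd.fderiv)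
    exact congrArg (· x) h4
  -- Both partials of `v` are multiples of one vector `η`. As `⟪e, ∂ₜv⟫ = 1`, the product `⟪e, η⟫`
  -- is nonzero, so `⟪e, ∂ₛv⟫ = 0` kills the multiple in `∂ₛv`.
  have hvs : ∀ z ∈ box z₀ ε, fderiv ℝ v z (1, 0) = 0 := by
    intro z hz
    obtain ⟨η, hη⟩ := (hinc z hz).exists_smul
    obtain ⟨m, hm⟩ := hη _ ⟨(1, 0), rfl⟩
    obtain ⟨m', hm'⟩ := hη _ ⟨(0, 1), rfl⟩
    have e1 := he' z hz (1, 0)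
    have e2 := he' z hz (0, 1)
    rw [hv' z hz, ← ContinuousLinearMap.coe_coe (fderiv ℝ F z), hm, inner_smul_right] at e1
    rw [hv' z hz, ← ContinuousLinearMap.coe_coe (fderiv ℝ F z), hm', inner_smul_right] at e2
    have hm0 : m = 0 := (mul_eq_zero.1 e1).resolve_right fun h ↦ by simp [h] at e2
    rw [hv' z hz, ← ContinuousLinearMap.coe_coe (fderiv ℝ F z), hm, hm0, zero_smul]
  have hus : ∀ z ∈ box z₀ ε, fderiv ℝ F z (1, 0) = fderiv ℝ u z (1, 0) := by
    intro z hz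
    have := P.starProjection_add_starProjection_orthogonal (fderiv ℝ F z (1, 0))
    rw [← hv' z hz, hvs z hz, add_zero, ← hu' z hz] at this
    exact this.symm
  let S : ℝ × ℝ → R4 := fun z ↦ fderiv ℝ u z (1, 0)
  have hSs : ContDiffOn ℝ ∞ S (box z₀ ε) :=
    (hu.fderiv_of_isOpen hB (by simp)).clm_apply contDiffOn_const
  have hTs : ContDiffOn ℝ ∞ (fun z ↦ fderiv ℝ u z (0, 1)) (box z₀ ε) :=
    (hu.fderiv_of_isOpen hB (by simp)).clm_apply contDiffOn_const
  have hS0 : ∀ z ∈ box z₀ ε, S z ≠ 0 := by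
    intro z hz h
    have h2 : fderiv ℝ F z (1, 0) = 0 := (hus z hz).trans h
    have h3 := (injective_iff_map_eq_zero _).1 (hinj z hz) _ h2
    simp at h3
  have hSP : ∀ z ∈ box z₀ ε, S z ∈ P := fun z hz ↦ by
    simp only [S, hu' z hz]; exact Submodule.starProjection_apply_mem _ _
  obtain ⟨J, hJP, hJo, hJn⟩ := exists_rotation P hP
  let N : ℝ × ℝ → R4 := fun z ↦ ‖S z‖⁻¹ • J (S z)
  have hNs : ContDiffOn ℝ ∞ N (box z₀ ε) :=
    ((hSs.norm ℝ hS0).inv fun z hz ↦ norm_ne_zero_iff.2 (hS0 z hz)).smul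
      (J.contDiff.comp_contDiffOn hSs)
  have hNP : ∀ z, N z ∈ P := fun z ↦ P.smul_mem _ (hJP _)
  have hN1 : ∀ z ∈ box z₀ ε, ‖N z‖ = 1 := fun z hz ↦ by
    simp only [N, norm_smul, hJn _ (hSP z hz), norm_inv, norm_norm]
    exact inv_mul_cancel₀ (norm_ne_zero_iff.2 (hS0 z hz))
  have hNS : ∀ z, ⟪N z, S z⟫ = 0 := fun z ↦ by simp only [N, inner_smul_left, hJo, mul_zero]
  let β : ℝ → R4 := fun t ↦ v (z₀.1, t)
  have hline : ∀ t ∈ Ioo (z₀.2 - ε) (z₀.2 + ε), (z₀.1, t) ∈ box z₀ ε := fun t ht ↦ ⟨hz₀.1, ht⟩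
  have hβ : ContDiffOn ℝ ∞ β (Ioo (z₀.2 - ε) (z₀.2 + ε)) :=
    hv.comp (contDiffOn_const.prodMk contDiffOn_id) hline
  have hvβ : ∀ z ∈ box z₀ ε, v z = β z.2 := fun z hz ↦
    eq_of_fderiv_fst_eq_zero (hv.differentiableOn (by simp)) hvs hz hz₀.1
  have hβ' : ∀ z ∈ box z₀ ε, deriv β z.2 = fderiv ℝ v z (0, 1) := by
    intro z hz
    have h2 : (fun t ↦ v (z.1, t)) =ᶠ[𝓝 z.2] β := by
      filter_upwards [isOpen_Ioo.mem_nhds hz.2] with t ht using hvβ (z.1, t) ⟨hz.1, ht⟩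
    rw [← h2.deriv_eq]
    exact (hasDerivAt_snd ((hv.contDiffAt (hB.mem_nhds hz)).differentiableAt (by simp))).deriv
  have hβ0 : ∀ t ∈ Ioo (z₀.2 - ε) (z₀.2 + ε), deriv β t ≠ 0 := by
    intro t ht h
    have h2 := he' _ (hline t ht) (0, 1)
    rw [← hβ' _ (hline t ht), h, inner_zero_right] at h2
    exact zero_ne_one h2
  let κ : ℝ → ℝ := fun t ↦ Real.cos θ / Real.sin θ * ‖deriv β t‖
  have hκs : ContDiffOn ℝ ∞ κ (Ioo (z₀.2 - ε) (z₀.2 + ε)) :=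
    contDiffOn_const.mul (((contDiffOn_infty_iff_deriv_of_isOpen isOpen_Ioo).1 hβ).2.norm ℝ hβ0)
  have hNT : ∀ z ∈ box z₀ ε, |⟪N z, fderiv ℝ u z (0, 1)⟫| = κ z.2 := by
    intro z hz
    have h2 := (hinc z hz).slope (S z) ⟨(1, 0), hus z hz⟩ (hSP z hz) (hS0 z hz) (N z) (hNP z)
      (hN1 z hz) (hNS z) (fderiv ℝ F z (0, 1)) ⟨(0, 1), rfl⟩
    rw [← hv' z hz, ← hβ' z hz] at h2
    rw [hu' z hz, inner_starProjection_of_mem (hNP z)]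
    simp only [κ]
    field_simp
    linarith
  -- The slope relation gives `⟪N, ∂ₜu⟫` only up to sign. If `cos θ = 0` both sides vanish;
  -- otherwise `κ` has no zero and the sign is constant on the connected box, so it can be absorbed
  -- into `N`.
  have hsign : ∃ σ : ℝ, |σ| = 1 ∧
      ∀ z ∈ box z₀ ε, σ * ⟪N z, fderiv ℝ u z (0, 1)⟫ = κ z.2 := by
    rcases hc0.eq_or_lt with hc | hc
    · refine ⟨1, abs_one, fun z hz ↦ ?_⟩
      have h2 := hNT z hz
      simp only [κ, ← hc, zero_div, zero_mul, abs_eq_zero] at h2 ⊢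
      rw [h2, mul_zero]
    · have hpre : IsPreconnected (box z₀ ε) := isPreconnected_Ioo.prod isPreconnected_Ioo
      have h2 := hpre.eq_or_eq_neg_of_sq_eq (f := fun z ↦ ⟪N z, fderiv ℝ u z (0, 1)⟫)
        (g := fun z ↦ κ z.2) (hNs.continuousOn.inner hTs.continuousOn)
        (hκs.continuousOn.comp continuousOn_snd fun z hz ↦ hz.2)
        (fun z hz ↦ by simp only [Pi.pow_apply, ← hNT z hz, sq_abs])
        (fun {z} hz ↦ mul_ne_zero (div_pos hc hθ).ne' (norm_ne_zero_iff.2 (hβ0 _ hz.2)))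
      rcases h2 with h2 | h2
      · exact ⟨1, abs_one, fun z hz ↦ by rw [one_mul]; exact h2 hz⟩
      · refine ⟨-1, by simp, fun z hz ↦ ?_⟩
        have h3 := h2 hz
        simp only [Pi.neg_apply] at h3
        rw [h3]
        ring
  obtain ⟨σ, hσ, hσN⟩ := hsign
  obtain ⟨U, hU, hUo, hzU, hUT⟩ := exists_isUnionOfHolonomyTubes_of_frame hP h0 h1 (u := u)
    (N := fun z ↦ σ • N z) (β := β) (κ := κ) hε hu (hNs.const_smul σ)
    (fun z _ ↦ Submodule.starProjection_apply_mem _ _) (fun z _ ↦ P.smul_mem _ (hNP z))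
    (fun z hz ↦ by rw [norm_smul, hN1 z hz, Real.norm_eq_abs, hσ, mul_one]) hS0
    (fun z _ ↦ by rw [inner_smul_left]; exact mul_eq_zero_of_right _ (hNS z))
    (fun z hz ↦ by rw [inner_smul_left]; exact hσN z hz) hβ
    (fun t _ ↦ Submodule.starProjection_apply_mem _ _) hκs
    (fun t _ ↦ mul_nonneg (div_nonneg hc0 hθ.le) (norm_nonneg _))
    (fun t _ ↦ by simp only [κ]; field_simp) (fun t ht ↦ Or.inr (hβ0 t ht))
  refine ⟨U, hU, hUo, hzU, ?_⟩
  convert hUT using 1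
  exact image_congr fun z hz ↦ by rw [← huv z, hvβ z (hU hz)]

/-- The `Pᗮ`-component is locally constant, so orthonormal coordinates of `P` present the surface as
an open piece of a translate of `P`. It is swept out by parallel lines: `c s = s • p` with constant
normal `q`, `R t = t` and constant `β`. -/
lemma exists_isUnionOfHolonomyTubes_of_parallel {E : Type*} [NormedAddCommGroup E]
    [NormedSpace ℝ E] [FiniteDimensional ℝ E] (hE : Module.finrank ℝ E = 2)
    {P : Submodule ℝ R4} (hP : Module.finrank ℝ P = 2) {F : E → R4} {Ω : Set E} (hΩ : IsOpen Ω)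
    (hF : ContDiffOn ℝ ∞ F Ω) {y : E} (hy : y ∈ Ω) (hinj : Function.Injective (fderiv ℝ F y))
    (hFP : ∀ x ∈ Ω, ∀ v, fderiv ℝ F x v ∈ P) :
    ∃ U ⊆ Ω, IsOpen U ∧ y ∈ U ∧ IsUnionOfHolonomyTubes P 0 (F '' U) := by
  obtain ⟨p, hp, q, hq, hp1, hq1, hpq⟩ := exists_orthonormal_pair P hP
  have hFd : ∀ x ∈ Ω, DifferentiableAt ℝ F x := fun x hx ↦
    (hF.contDiffAt (hΩ.mem_nhds hx)).differentiableAt (by simp)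
  let L : R4 →L[ℝ] ℝ × ℝ := (innerSL ℝ p).prod (innerSL ℝ q)
  have hL : ∀ x, L x = (⟪p, x⟫, ⟪q, x⟫) := fun x ↦ rfl
  have hGinj : Function.Injective (fderiv ℝ (L ∘ F) y) := by
    rw [(L.hasFDerivAt.comp y (hFd y hy).hasFDerivAt).fderiv, injective_iff_map_eq_zero]
    intro v hv
    rw [ContinuousLinearMap.comp_apply, hL, Prod.mk_eq_zero] at hv
    refine (injective_iff_map_eq_zero _).1 hinj v ?_
    rw [eq_add_of_orthonormal_pair hP hp hq hp1 hq1 hpq (hFP y hy v), real_inner_comm, hv.1,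
      real_inner_comm, hv.2, zero_smul, zero_smul, add_zero]
  obtain ⟨Ψ, ε, hε, hΨ, hΨy, hΨΩ, hGΨ, hopen⟩ := exists_box_chart hE hΩ
    (L.contDiff.comp_contDiffOn hF) hy hGinj
  set z₀ := (L ∘ F) y with hz₀'
  have hB := isOpen_box z₀ ε
  have hz₀ := mem_box_self z₀ hε
  have hΨd : ∀ z ∈ box z₀ ε, DifferentiableAt ℝ Ψ z := fun z hz ↦
    (hΨ.contDiffAt (hB.mem_nhds hz)).differentiableAt (by simp)
  have hder : ∀ z ∈ box z₀ ε,
      HasFDerivAt (fun z ↦ Pᗮ.starProjection (F (Ψ z))) (0 : ℝ × ℝ →L[ℝ] R4) z := by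
    intro z hz
    refine (Pᗮ.starProjection.hasFDerivAt.comp z
      ((hFd _ (hΨΩ hz)).hasFDerivAt.comp z (hΨd z hz).hasFDerivAt)).congr_fderiv ?_
    refine ContinuousLinearMap.ext fun v ↦ ?_
    exact (Submodule.starProjection_apply_eq_zero_iff _).2 (by simpa using hFP _ (hΨΩ hz) _)
  have hdiff : DifferentiableOn ℝ (fun z ↦ Pᗮ.starProjection (F (Ψ z))) (box z₀ ε) :=
    fun z hz ↦ (hder z hz).differentiableAt.differentiableWithinAt
  have hconst : ∀ z ∈ box z₀ ε, Pᗮ.starProjection (F (Ψ z)) = Pᗮ.starProjection (F y) := by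
    intro z hz
    have e1 := eq_of_fderiv_fst_eq_zero hdiff (fun z hz ↦ by rw [(hder z hz).fderiv]; rfl) hz
      hz₀.1
    have e2 := eq_of_fderiv_snd_eq_zero hdiff (fun z hz ↦ by rw [(hder z hz).fderiv]; rfl)
      (z := (z₀.1, z.2)) ⟨hz₀.1, hz.2⟩ hz₀.2
    refine e1.trans (e2.trans ?_)
    simp only [Prod.mk.eta, hΨy]
  have hFΨ : ∀ z ∈ box z₀ ε, F (Ψ z) = z.1 • p + (z.2 • q + Pᗮ.starProjection (F y)) := by
    intro z hz
    have h2 := P.starProjection_add_starProjection_orthogonal (F (Ψ z))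
    have h3 : L (F (Ψ z)) = z := hGΨ z hz
    rw [hL, Prod.ext_iff] at h3
    simp only at h3
    rw [hconst z hz, eq_add_of_orthonormal_pair hP hp hq hp1 hq1 hpq
      (P.starProjection_apply_mem (F (Ψ z))), real_inner_comm p, inner_starProjection_of_mem hp,
      real_inner_comm q, inner_starProjection_of_mem hq, h3.1, h3.2, add_assoc] at h2
    exact h2.symm
  have hcd : ∀ s : ℝ, HasDerivAt (fun s : ℝ ↦ s • p) p s := fun s ↦ by
    simpa using (hasDerivAt_id s).smul_const p
  refine ⟨Ψ '' box z₀ ε, ?_, hopen _ subset_rfl hB, ⟨z₀, hz₀, hΨy⟩, ?_⟩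
  · rintro _ ⟨z, hz, rfl⟩
    exact hΨΩ hz
  · refine isUnionOfHolonomyTubes_of_eq hP le_rfl (by positivity) (c := fun s ↦ s • p)
      (n := fun _ ↦ q) (β := fun _ ↦ Pᗮ.starProjection (F y)) (R := fun t ↦ t)
      (κ := fun _ ↦ 1) (a := z₀.1 - ε) (b := z₀.1 + ε) (a' := z₀.2 - ε) (b' := z₀.2 + ε)
      (s₀ := z₀.1) hz₀.1 (by linarith)
      ⟨contDiffOn_id.smul contDiffOn_const, fun s _ h ↦ ?_⟩ (fun s _ ↦ P.smul_mem _ hp)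
      (differentiableOn_const _) (fun _ _ ↦ hq) (fun _ _ ↦ hq1)
      (fun s _ ↦ by rw [(hcd s).deriv]; exact hpq) contDiffOn_const
      (fun _ _ ↦ Submodule.starProjection_apply_mem _ _) contDiffOn_id
      (fun t _ ↦ hasDerivAt_id t) (fun _ _ ↦ zero_le_one) (fun _ _ ↦ by simp)
      (fun _ _ ↦ Or.inl one_ne_zero) ?_
    · rw [(hcd s).deriv] at h
      simp [h] at hp1
    · rw [image_image]
      exact image_congr fun z hz ↦ hFΨ z hz

lemma exists_isUnionOfHolonomyTubes {E : Type*} [NormedAddCommGroup E] [NormedSpace ℝ E]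
    [FiniteDimensional ℝ E] (hE : Module.finrank ℝ E = 2) {P : Submodule ℝ R4}
    (hP : Module.finrank ℝ P = 2) {θ : ℝ} {F : E → R4} {Ω : Set E} (hΩ : IsOpen Ω)
    (hF : ContDiffOn ℝ ∞ F Ω) {y : E} (hy : y ∈ Ω)
    (hinj : ∀ x ∈ Ω, Function.Injective (fderiv ℝ F x))
    (hang : ∀ x ∈ Ω, ArePrincipalAngles (LinearMap.range (fderiv ℝ F x).toLinearMap) P 0 θ) :
    ∃ U ⊆ Ω, IsOpen U ∧ y ∈ U ∧ IsUnionOfHolonomyTubes P θ (F '' U) := by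
  have hT : ∀ x ∈ Ω, Module.finrank ℝ (LinearMap.range (fderiv ℝ F x).toLinearMap) = 2 :=
    fun x hx ↦ (LinearMap.finrank_range_of_inj (hinj x hx)).trans hE
  have h0 := (hang y hy).le
  have h1 := (hang y hy).le_pi_div_two
  rcases h0.eq_or_lt with rfl | hpos
  · exact exists_isUnionOfHolonomyTubes_of_parallel hE hP hΩ hF hy (hinj y hy) fun x hx v ↦
      (hang x hx).le_of_zero (hT x hx) hP ⟨v, rfl⟩
  have hθ : 0 < Real.sin θ := Real.sin_pos_of_pos_of_lt_pi hpos (by linarith [Real.pi_pos])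
  have hFd : ∀ x ∈ Ω, DifferentiableAt ℝ F x := fun x hx ↦
    (hF.contDiffAt (hΩ.mem_nhds hx)).differentiableAt (by simp)
  obtain ⟨e, w, η, he, hw, hη, he1, hw1, hew, hη1, -, hspan⟩ :=
    (hang y hy).exists_basis (hT y hy) hP
  -- On `x • e + y • (cos θ • w + η)` this map gives `(x, y * sin θ ^ 2)`, so it is injective on the
  -- tangent plane at the base point. As `η ∈ Pᗮ`, its second component is a height over `P`.
  let L : R4 →L[ℝ] ℝ × ℝ := (innerSL ℝ e).prod (innerSL ℝ η)
  have hL : ∀ x, L x = (⟪e, x⟫, ⟪η, x⟫) := fun x ↦ rfl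
  have hηe : ⟪η, e⟫ = 0 := Submodule.inner_left_of_mem_orthogonal he hη
  have hηw : ⟪η, w⟫ = 0 := Submodule.inner_left_of_mem_orthogonal hw hη
  have heη : ⟪e, η⟫ = 0 := hη e he
  have hGinj : Function.Injective (fderiv ℝ (L ∘ F) y) := by
    rw [(L.hasFDerivAt.comp y (hFd y hy).hasFDerivAt).fderiv, injective_iff_map_eq_zero]
    intro v hv
    rw [ContinuousLinearMap.comp_apply, hL, Prod.mk_eq_zero] at hv
    refine (injective_iff_map_eq_zero _).1 (hinj y hy) v ?_
    obtain ⟨a, b, hab⟩ := hspan (fderiv ℝ F y v) ⟨v, rfl⟩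
    rw [hab] at hv ⊢
    simp only [inner_add_right, inner_smul_right, hηe, hηw, hew, heη, real_inner_self_eq_norm_sq,
      he1, hη1, mul_zero, zero_add, add_zero, one_pow, mul_one] at hv
    rw [hv.1, (mul_eq_zero.1 hv.2).resolve_right (pow_ne_zero 2 hθ.ne'), zero_smul, zero_smul,
      add_zero]
  have hLF : ContDiffOn ℝ ∞ (L ∘ F) Ω := L.contDiff.comp_contDiffOn hF
  obtain ⟨Ψ, ε, hε, hΨ, hΨy, hΨΩ, hGΨ, hopen⟩ := exists_box_chart hE hΩ hLF hy hGinj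
  have hB := isOpen_box ((L ∘ F) y) ε
  have hΨd : ∀ z ∈ box ((L ∘ F) y) ε, DifferentiableAt ℝ Ψ z := fun z hz ↦
    (hΨ.contDiffAt (hB.mem_nhds hz)).differentiableAt (by simp)
  have hd : ∀ z ∈ box ((L ∘ F) y) ε,
      fderiv ℝ (F ∘ Ψ) z = (fderiv ℝ F (Ψ z)).comp (fderiv ℝ Ψ z) := fun z hz ↦
    ((hFd _ (hΨΩ hz)).hasFDerivAt.comp z (hΨd z hz).hasFDerivAt).fderiv
  have hinj' : ∀ z ∈ box ((L ∘ F) y) ε, Function.Injective (fderiv ℝ (F ∘ Ψ) z) := by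
    intro z hz
    rw [hd z hz]
    refine (hinj _ (hΨΩ hz)).comp (Function.LeftInverse.injective
      (g := fderiv ℝ (L ∘ F) (Ψ z)) ?_)
    exact fderiv_injective_of_leftInverse hB hGΨ hz
      ((hLF.contDiffAt (hΩ.mem_nhds (hΨΩ hz))).differentiableAt (by simp)) (hΨd z hz)
  have hinc : ∀ z ∈ box ((L ∘ F) y) ε,
      IsInclined P (LinearMap.range (fderiv ℝ (F ∘ Ψ) z).toLinearMap) θ := by
    intro z hz
    refine ((hang _ (hΨΩ hz)).isInclined (hT _ (hΨΩ hz)) hP hθ).mono ?_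
    rintro _ ⟨v, rfl⟩
    exact ⟨fderiv ℝ Ψ z v, by rw [hd z hz]; rfl⟩
  obtain ⟨U, hU, hUo, hzU, hUT⟩ := exists_isUnionOfHolonomyTubes_of_box hP h0 h1 hθ
    (F := F ∘ Ψ) hε (hF.comp hΨ hΨΩ) hinj' hinc hη (fun z hz ↦ (Prod.ext_iff.1 (hGΨ z hz)).2)
  refine ⟨Ψ '' U, ?_, hopen U hU hUo, ⟨_, hzU, hΨy⟩, by rwa [← image_comp]⟩
  rintro _ ⟨z, hz, rfl⟩
  exact hΨΩ (hU hz)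

end Local

/-! ### Passage from the manifold to a chart. -/

theorem mainTheorem6 {M : Type*} [TopologicalSpace M]
    [ChartedSpace (EuclideanSpace ℝ (Fin 2)) M] [IsManifold (𝓡 2) ∞ M]
    (f : M → R4) (hf : IsImmersedSurface f)
    (P : Submodule ℝ R4) (hP : Module.finrank ℝ P = 2)
    (θ₂ : ℝ) (hangles : HasConstantPrincipalAngles f P 0 θ₂) :
    ∃ φ : R4 ≃ᵃⁱ[ℝ] R4, φ.linearIsometryEquiv = LinearIsometryEquiv.refl ℝ R4 ∧
      ∀ x : M, ∀ W ∈ 𝓝 x, ∃ U : Set M, U ⊆ W ∧ IsOpen U ∧ x ∈ U ∧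
        IsUnionOfHolonomyTubes P θ₂ (φ '' (f '' U)) := by
  -- The trivial translation is enough: the offset of the surface from the linear plane `P` is
  -- carried by the `Pᗮ`-component `β` of `γ`.
  refine ⟨AffineIsometryEquiv.refl ℝ R4, rfl, fun x W hW ↦ ?_⟩
  obtain ⟨W', hW'W, hW'o, hxW'⟩ := mem_nhds_iff.1 hW
  have : IsManifold (𝓡 2) 1 M := IsManifold.of_le (n := ∞) (by simp)
  let φ := extChartAt (𝓡 2) x
  let F : EuclideanSpace ℝ (Fin 2) → R4 := f ∘ φ.symm
  let Ω := φ.target ∩ φ.symm ⁻¹' W'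
  have hΩ : IsOpen Ω := (continuousOn_extChartAt_symm x).isOpen_inter_preimage
    (isOpen_extChartAt_target x) hW'o
  have hxΩ : φ x ∈ Ω := ⟨mem_extChartAt_target x, by
    simp only [mem_preimage, φ, extChartAt_to_inv]; exact hxW'⟩
  have hF : ContDiffOn ℝ ∞ F φ.target := by
    rw [← contMDiffOn_iff_contDiffOn]
    exact hf.contMDiff.comp_contMDiffOn (contMDiffOn_extChartAt_symm x)
  have hFd : ∀ y ∈ φ.target, DifferentiableAt ℝ F y := fun y hy ↦
    (hF.contDiffAt ((isOpen_extChartAt_target x).mem_nhds hy)).differentiableAt (by simp)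
  -- The differential of the chart is invertible, so `F` and `f` have the same tangent planes at
  -- corresponding points.
  have hder : ∀ y ∈ φ.target, ∃ A : EuclideanSpace ℝ (Fin 2) ≃L[ℝ] EuclideanSpace ℝ (Fin 2),
      (show EuclideanSpace ℝ (Fin 2) →L[ℝ] R4 from mfderiv (𝓡 2) 𝓘(ℝ, R4) f (φ.symm y)) =
        (fderiv ℝ F y).comp (A : EuclideanSpace ℝ (Fin 2) →L[ℝ] EuclideanSpace ℝ (Fin 2)) := by
    intro y hy
    have hys : φ.symm y ∈ φ.source := φ.map_target hy
    obtain ⟨A, hA⟩ := isInvertible_mfderiv_extChartAt (I := 𝓡 2) hys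
    refine ⟨A, ?_⟩
    have hφd : MDifferentiableAt (𝓡 2) 𝓘(ℝ, EuclideanSpace ℝ (Fin 2)) φ (φ.symm y) :=
      mdifferentiableAt_extChartAt (by simpa [φ] using hys)
    have hy' : φ (φ.symm y) = y := φ.right_inv hy
    have hFm : MDifferentiableAt 𝓘(ℝ, EuclideanSpace ℝ (Fin 2)) 𝓘(ℝ, R4) F (φ (φ.symm y)) := by
      rw [hy']; exact (hFd y hy).mdifferentiableAt
    have h2 := mfderiv_comp (φ.symm y) hFm hφd
    have h3 : F ∘ φ =ᶠ[𝓝 (φ.symm y)] f := by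
      filter_upwards [(isOpen_extChartAt_source x).mem_nhds hys] with z hz
      exact congrArg f (φ.left_inv hz)
    rw [h3.mfderiv_eq, mfderiv_eq_fderiv, hy'] at h2
    rw [← hA] at h2
    exact h2
  have hinj : ∀ y ∈ Ω, Function.Injective (fderiv ℝ F y) := by
    intro y hy
    obtain ⟨A, hA⟩ := hder y hy.1
    have h2 := hf.injective_mfderiv (φ.symm y)
    have h3 : Function.Injective ((fderiv ℝ F y) ∘ A) := by
      have := congrArg DFunLike.coe hA
      rw [ContinuousLinearMap.coe_comp] at this
      rw [← ContinuousLinearEquiv.coe_coe, ← this]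
      exact h2
    simpa [Function.comp_assoc] using h3.comp A.symm.injective
  have hang : ∀ y ∈ Ω,
      ArePrincipalAngles (LinearMap.range (fderiv ℝ F y).toLinearMap) P 0 θ₂ := by
    intro y hy
    obtain ⟨A, hA⟩ := hder y hy.1
    have h2 := hangles (φ.symm y)
    rw [tangentPlane, hA] at h2
    convert h2 using 1
    ext q
    constructor
    · rintro ⟨v, rfl⟩
      exact ⟨A.symm v, by simp⟩
    · rintro ⟨v, rfl⟩
      exact ⟨A v, rfl⟩
  obtain ⟨U, hU, hUo, hxU, hUT⟩ := exists_isUnionOfHolonomyTubes (by simp) hP hΩ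
    (hF.mono inter_subset_left) hxΩ hinj hang
  refine ⟨φ.source ∩ φ ⁻¹' U, ?_, (continuousOn_extChartAt x).isOpen_inter_preimage
    (isOpen_extChartAt_source x) hUo, ⟨mem_extChartAt_source x, hxU⟩, ?_⟩
  · rintro z ⟨hz, hzU⟩
    have := (hU hzU).2
    rw [mem_preimage, φ.left_inv hz] at this
    exact hW'W this
  · convert hUT using 1
    ext q
    simp only [AffineIsometryEquiv.coe_refl, image_id]
    constructor
    · rintro ⟨z, ⟨hz, hzU⟩, rfl⟩
      exact ⟨φ z, hzU, congrArg f (φ.left_inv hz)⟩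
    · rintro ⟨y, hy, rfl⟩
      refine ⟨φ.symm y, ⟨φ.map_target (hU hy).1, ?_⟩, rfl⟩
      rwa [mem_preimage, φ.right_inv (hU hy).1]
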